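/- Let $H$ be an infinite-dimensional complex Hilbert space (not necessarily separable), $\mathcal B(H)$ the algebra of bounded operators and $\mathcal K(H)$ the compact operators on $H$. A *symmetric quasi-Banach ideal* is a nonzero two-sided ideal $\mathcal I\subseteq\mathcal K(H)$ of $\mathcal B(H)$ with a complete quasi-norm $\|\cdot\|_{\mathcal I}$ such that $\|axb\|_{\mathcal I}\le\|a\|_{\mathcal B(H)}\|x\|_{\mathcal I}\|b\|_{\mathcal B(H)}$ for $x\in\mathcal I$, $a,b\in\mathcal B(H)$, and $\|p\|_{\mathcal I}=1$ for every one-dimensional orthogonal projection $p$. The *modulus of concavity* of a quasi-norm is the least $C\ge1$ with $\|x+y\|\le C(\|x\|+\|y\|)$ for all $x,y$. For $x\in\mathcal K(H)$ let $s(x)=\{s_n(x)\}_{n\ge1}$ be its singular values, i.e. the eigenvalues of $|x|=(x^*x)^{1/2}$ in decreasing order, repeated according to multiplicity (and followed by zeros if $x$ has finite rank). For a bounded real sequence $\xi$ let $\xi^*$ be the decreasing rearrangement of $|\xi|$. For an ideal $\mathcal I\subseteq\mathcal K(H)$ with a symmetric quasi-norm put $E_{\mathcal I}=\{\xi\in c_0:\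 \xi^*=s(x)\text{ for some }x\in\mathcal I\}$ (real sequences), with $\|\xi\|_{E_{\mathcal I}}=\|x\|_{\mathcal I}$ for any such $x$. For a set $E$ of bounded real sequences with quasi-norm $\|\cdot\|_E$ put $C_E=\{x\in\mathcal K(H):\ s(x)\in E\}$ and $\|x\|_{C_E}=\|s(x)\|_E$. For symmetric quasi-Banach ideals $\mathcal I,\mathcal J$ put $$\mathcal J:\mathcal I=\{a\in\mathcal B(H):\ ax\in\mathcal J\ \ \forall x\in\mathcal I\},\qquad \|a\|_{\mathcal J:\mathcal I}=\sup\{\|ax\|_{\mathcal J}:\ x\in\mathcal I,\ \|x\|_{\mathcal I}\le1\},$$ $$E_{\mathcal J}:E_{\mathcal I}=\{\xi\in l_\infty:\ \xi\eta\in E_{\mathcal J}\ \ \forall\eta\in E_{\mathcal I}\},\qquad \|\xi\|_{E_{\mathcal J}:E_{\mathcal I}}=\sup\{\|\xi\eta\|_{E_{\mathcal J}}:\ \eta\in E_{\mathcal I},\ \|\eta\|_{E_{\mathcal I}}\le1\}.$$ **Theorem.** Let $\mathcal I,\mathcal J$ be symmetric quasi-Banach ideals of compact operators on $H$ with $\mathcal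 I\not\subseteq\mathcal J$. Then both suprema above are finite for all $a\in\mathcal J:\mathcal I$ and $\xi\in E_{\mathcal J}:E_{\mathcal I}$, the value $\|\xi\|_{E_{\mathcal J:\mathcal I}}=\|a\|_{\mathcal J:\mathcal I}$ (for $a\in\mathcal J:\mathcal I$ with $s(a)=\xi^*$) does not depend on the choice of $a$, and: (i) $E_{\mathcal J:\mathcal I}=E_{\mathcal J}:E_{\mathcal I}$, and on this space $\|\cdot\|_{E_{\mathcal J}:E_{\mathcal I}}\le\|\cdot\|_{E_{\mathcal J:\mathcal I}}\le 2C\,\|\cdot\|_{E_{\mathcal J}:E_{\mathcal I}}$, where $C$ is the modulus of concavity of $\|\cdot\|_{\mathcal J}$; (ii) $\mathcal J:\mathcal I=C_{E_{\mathcal J}:E_{\mathcal I}}$, and on this ideal $\|\cdot\|_{C_{E_{\mathcal J}:E_{\mathcal I}}}\le\|\cdot\|_{\mathcal J:\mathcal I}\le 2C'\,\|\cdot\|_{C_{E_{\mathcal J}:E_{\mathcal I}}}$, where $C'$ is the modulus of concavity of $\|\cdot\|_{E_{\mathcal J}}$. -/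

import Mathlib

open Filter Topology

noncomputable section

namespace CalkinDual

/-! ### Generalities on quasi-norms and multipliers

A quasi-normed space is given by its underlying set `S` of elements of an ambient vector space
and a real function `N` on the ambient space, of which only the values on `S` are ever used. -/

/-- The modulus of concavity: the least `C ≥ 1` with `N (x + y) ≤ C (N x + N y)` on `S`. -/
def concavityModulus {X : Type*} [Add X] (S : Set X) (N : X → ℝ) : ℝ :=
  sInf {C : ℝ | 1 ≤ C ∧ ∀ x ∈ S, ∀ y ∈ S, N (x + y) ≤ C * (N x + N y)}

/-- The values whose supremum is the multiplier quasi-norm of `a`: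
all `NJ (a * x)` with `x ∈ I` and `NI x ≤ 1`. -/
def multiplierValues {X : Type*} [Mul X] (NJ : X → ℝ) (I : Set X) (NI : X → ℝ) (a : X) : Set ℝ :=
  {r : ℝ | ∃ x ∈ I, NI x ≤ 1 ∧ r = NJ (a * x)}

/-- The multiplier quasi-norm `sup {NJ (a * x) : x ∈ I, NI x ≤ 1}`. -/
def multiplierNorm {X : Type*} [Mul X] (NJ : X → ℝ) (I : Set X) (NI : X → ℝ) (a : X) : ℝ :=
  sSup (multiplierValues NJ I NI a)

/-! ### Sequences. All sequences are indexed from `0`. -/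

/-- The decreasing rearrangement of `|ξ|`: its `n`-th term (counting from `0`) is the infimum of
the `s > 0` that are exceeded by at most `n` of the numbers `|ξ k|`. -/
def rearrangement (ξ : ℕ → ℝ) (n : ℕ) : ℝ :=
  sInf {s : ℝ | 0 < s ∧ {k : ℕ | s < |ξ k|}.encard ≤ (n : ℕ∞)}

/-- The `F`-dual space `F : G` of `G`: bounded real sequences `ξ` with `ξ η ∈ F` for all
`η ∈ G` (termwise product). -/
def seqDual (F G : Set (ℕ → ℝ)) : Set (ℕ → ℝ) :=
  {ξ | (∃ M : ℝ, ∀ n, |ξ n| ≤ M) ∧ ∀ η ∈ G, ξ * η ∈ F}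

/-! ### Operators -/

variable {H : Type*} [NormedAddCommGroup H] [InnerProductSpace ℂ H] [CompleteSpace H]

/-- The sum of the eigenspaces of `|x| = (x* x)^(1/2)` for the eigenvalues greater than `t`. Its
dimension is the number of eigenvalues of `|x|` greater than `t`, counted with multiplicity. -/
def eigenspacesAbove (x : H →L[ℂ] H) (t : ℝ) : Submodule ℂ H :=
  ⨆ (r : ℝ) (_ : t < r),
    Module.End.eigenspace ((CFC.abs x : H →L[ℂ] H) : H →ₗ[ℂ] H) (r : ℂ)

/-- The singular values of a compact operator `x`: the eigenvalues of `|x|` in decreasing order,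
repeated according to multiplicity, and followed by zeros if `x` has finite rank. The `n`-th one
(counting from `0`) is the least `t ≥ 0` such that at most `n` of the eigenvalues, counted with
multiplicity, exceed `t`. -/
def singularValue (x : H →L[ℂ] H) (n : ℕ) : ℝ :=
  sInf {t : ℝ | 0 < t ∧ Module.rank ℂ (eigenspacesAbove x t) ≤ (n : Cardinal)}

variable (H) in
/-- A symmetric quasi-Banach ideal of compact operators on `H`: a nonzero two-sided ideal of
`B(H)` consisting of compact operators, with a complete symmetric quasi-norm. The values of
`qnorm` outside the ideal are irrelevant. -/
structure SymmetricQuasiBanachIdeal where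
  ideal : TwoSidedIdeal (H →L[ℂ] H)
  qnorm : (H →L[ℂ] H) → ℝ
  ne_bot : ideal ≠ ⊥
  compact : ∀ x ∈ ideal, IsCompactOperator x
  nonneg : ∀ x ∈ ideal, 0 ≤ qnorm x
  eq_zero_iff : ∀ x ∈ ideal, (qnorm x = 0 ↔ x = 0)
  smul : ∀ (c : ℂ), ∀ x ∈ ideal, qnorm (c • x) = ‖c‖ * qnorm x
  add_le : ∃ C : ℝ, 1 ≤ C ∧ ∀ x ∈ ideal, ∀ y ∈ ideal, qnorm (x + y) ≤ C * (qnorm x + qnorm y)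
  complete : ∀ u : ℕ → (H →L[ℂ] H), (∀ n, u n ∈ ideal) →
    (∀ ε > 0, ∃ N, ∀ m ≥ N, ∀ n ≥ N, qnorm (u m - u n) < ε) →
    ∃ x ∈ ideal, Tendsto (fun n => qnorm (u n - x)) atTop (𝓝 0)
  symm_le : ∀ x ∈ ideal, ∀ a b : H →L[ℂ] H, qnorm (a * x * b) ≤ ‖a‖ * qnorm x * ‖b‖
  proj_eq_one : ∀ p ∈ ideal, IsStarProjection p →
    Module.finrank ℂ (LinearMap.range (p : H →ₗ[ℂ] H)) = 1 → qnorm p = 1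

/-- The set of operators of a symmetric quasi-Banach ideal. -/
def SymmetricQuasiBanachIdeal.ops (I : SymmetricQuasiBanachIdeal H) : Set (H →L[ℂ] H) :=
  {x | x ∈ I.ideal}

/-- The `J`-dual space `J : I` of `I`: the bounded operators `a` with `a x ∈ J` for all `x ∈ I`. -/
def idealDual (J I : Set (H →L[ℂ] H)) : Set (H →L[ℂ] H) :=
  {a | ∀ x ∈ I, a * x ∈ J}

/-- The sequence space `E_S` of a set `S` of compact operators: the null sequences `ξ` whose
decreasing rearrangement is the sequence of singular values of some operator in `S`. -/
def seqSpace (S : Set (H →L[ℂ] H)) : Set (ℕ → ℝ) :=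
  {ξ | Tendsto ξ atTop (𝓝 0) ∧ ∃ x ∈ S, rearrangement ξ = singularValue x}

/-- The quasi-norm of `E_S` induced by a quasi-norm `N` on `S`: the value at `ξ` is the common
value `N x` of all `x ∈ S` whose singular values form the decreasing rearrangement of `ξ`
(written as an infimum so as to be a total function). -/
def seqNorm (S : Set (H →L[ℂ] H)) (N : (H →L[ℂ] H) → ℝ) (ξ : ℕ → ℝ) : ℝ :=
  sInf {r : ℝ | ∃ x ∈ S, rearrangement ξ = singularValue x ∧ r = N x}

variable (H) in
/-- The set `C_E` of all compact operators on `H` whose singular values form a sequence in `E`. -/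
def opSpace (E : Set (ℕ → ℝ)) : Set (H →L[ℂ] H) :=
  {x | IsCompactOperator x ∧ singularValue x ∈ E}

/-- The quasi-norm on `C_E` induced by a quasi-norm `N` on `E`. -/
def opNorm (N : (ℕ → ℝ) → ℝ) (x : H →L[ℂ] H) : ℝ :=
  N (singularValue x)

namespace SymmetricQuasiBanachIdeal

/-- The sequence space `E_I`. -/
def E (I : SymmetricQuasiBanachIdeal H) : Set (ℕ → ℝ) := seqSpace I.ops

/-- The quasi-norm of `E_I`. -/
def normE (I : SymmetricQuasiBanachIdeal H) : (ℕ → ℝ) → ℝ := seqNorm I.ops I.qnorm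

/-- The operators in `J : I`. -/
def dual (J I : SymmetricQuasiBanachIdeal H) : Set (H →L[ℂ] H) := idealDual J.ops I.ops

/-- The quasi-norm of `J : I`. -/
def normDual (J I : SymmetricQuasiBanachIdeal H) : (H →L[ℂ] H) → ℝ :=
  multiplierNorm J.qnorm I.ops I.qnorm

/-- The sequence space `E_{J:I}`. -/
def EDual (J I : SymmetricQuasiBanachIdeal H) : Set (ℕ → ℝ) := seqSpace (J.dual I)

/-- The quasi-norm of `E_{J:I}`. -/
def normEDual (J I : SymmetricQuasiBanachIdeal H) : (ℕ → ℝ) → ℝ :=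
  seqNorm (J.dual I) (J.normDual I)

/-- The sequence space `E_J : E_I`. -/
def dualE (J I : SymmetricQuasiBanachIdeal H) : Set (ℕ → ℝ) := seqDual J.E I.E

/-- The quasi-norm of `E_J : E_I`. -/
def normDualE (J I : SymmetricQuasiBanachIdeal H) : (ℕ → ℝ) → ℝ :=
  multiplierNorm J.normE I.E I.normE

end SymmetricQuasiBanachIdeal

end CalkinDual

end

noncomputable section
namespace CalkinDual

/-! ### Sorting null families -/

/-! Two facts let everything pass between operators and sequences. By the Schmidt expansion, a
compact `x` and a diagonal operator with entries `s(x)`, placed along arbitrary orthonormal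
sequences, are obtained from each other by multiplying on both sides with contractions. So
membership in a symmetric ideal and the value of its quasi-norm depend on `s(x)` only
(`IsSymmetricGauge.mem_and_le_of_isSchmidt`). And along fixed orthonormal sequences, `diag` respects
termwise sums and products (`diag_add`, `diag_mul_diag`).

Testing a diagonal operator on diagonal operators therefore gives one inclusion in (i) and the lower
bound with constant 1. The converse rests on `s_{2n}(ax) ≤ s_n(a) s_n(x)`, indices from 0
(`IsSchmidt.mul_le`): `s(ax)` is dominated by `s(a)s(x)` with every term written twice, that is, by
the sum of two copies of it placed on the even and on the odd indices. One use of the quasi-triangle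
inequality in `E_J` then costs the factor `2C` (`mul_mem_and_qnorm_le`). Part (ii) is part (i) read
at `ξ = s(a)`.

The hypothesis that `I` is not contained in `J` makes the duals consist of compact operators and
null sequences: a noncompact operator in `J : I` would be left invertible on an infinite-dimensional
subspace (`exists_left_inverse_on_of_not_compact`), and this would push all of `I` into `J`. The
suprema are finite by a gliding hump: completeness of `I` packs a sequence of its unit ball into a
single element, in orthogonal blocks with geometric weights (`exists_mul_eq_smul`), on which an
unbounded multiplier could have no finite value. -/

theorem exists_injective_antitone {ι : Type*} [Infinite ι] (μ : ι → ℝ) (hμ : ∀ i, 0 ≤ μ i)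
    (hfin : ∀ ε > 0, {i | ε < μ i}.Finite) :
    ∃ π : ℕ → ι, Function.Injective π ∧ Antitone (μ ∘ π) ∧ Tendsto (μ ∘ π) atTop (𝓝 0) ∧
      ∀ i, i ∉ Set.range π → μ i = 0 := by
  classical
  -- Greedy choice outside `F`: if a positive value is left, only finitely many indices exceed half
  -- of it, so the maximum is taken over a finite set.
  have hmax : ∀ F : Finset ι, ∃ i, i ∉ F ∧ ∀ j, j ∉ F → μ j ≤ μ i := by
    intro F
    by_cases h : ∃ j, j ∉ F ∧ 0 < μ j
    · obtain ⟨j, hj, hjpos⟩ := h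
      have hS : ({i | μ j / 2 < μ i} \ (F : Set ι)).Finite := (hfin _ (half_pos hjpos)).sdiff
      obtain ⟨i, hi, hmax⟩ := hS.exists_maximalFor μ _ ⟨j, by simpa using ⟨by linarith, hj⟩⟩
      refine ⟨i, by simpa using hi.2, fun k hk => ?_⟩
      by_contra hlt
      have hik : μ i < μ k := not_le.1 hlt
      have hi1 : μ j / 2 < μ i := hi.1
      have hk' : k ∈ ({i | μ j / 2 < μ i} \ (F : Set ι)) :=
        ⟨hi1.trans hik, by simpa using hk⟩
      exact absurd (hmax hk' hik.le) hlt
    · push Not at h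
      obtain ⟨i, hi⟩ := Infinite.exists_notMem_finset F
      exact ⟨i, hi, fun j hj => (h j hj).trans (hμ i)⟩
  choose g hg hgmax using hmax
  let P : ℕ → Finset ι := fun n => Nat.rec ∅ (fun _ F => insert (g F) F) n
  have hP : ∀ n, P (n + 1) = insert (g (P n)) (P n) := fun _ => rfl
  have hmono : Monotone P := monotone_nat_of_le_succ fun n => by
    rw [hP]; exact Finset.subset_insert _ _
  let π : ℕ → ι := fun n => g (P n)
  have hmem : ∀ m n, m < n → π m ∈ P n := fun m n h =>
    hmono (Nat.succ_le_of_lt h) (by rw [hP]; exact Finset.mem_insert_self _ _)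
  have hinj : Function.Injective π := by
    intro m n h
    rcases lt_trichotomy m n with hlt | heq | hlt
    · exact absurd (show π n ∈ P n from h ▸ hmem m n hlt) (hg (P n))
    · exact heq
    · exact absurd (show π m ∈ P m from h ▸ hmem n m hlt) (hg (P m))
  have hPran : ∀ n, ∀ i ∈ P n, i ∈ Set.range π := by
    intro n
    induction n with
    | zero => intro i hi; exact absurd hi (Finset.notMem_empty i)
    | succ n ih =>
      intro i hi
      rw [hP, Finset.mem_insert] at hi
      rcases hi with rfl | hi
      · exact ⟨n, rfl⟩
      · exact ih i hi
  have hanti : Antitone (μ ∘ π) := antitone_nat_of_succ_le fun n =>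
    hgmax (P n) _ fun h => hg (P (n + 1)) (hmono n.le_succ h)
  have htend : Tendsto (μ ∘ π) atTop (𝓝 0) := by
    rw [Metric.tendsto_atTop]
    intro ε hε
    have hf : (π ⁻¹' {i | ε / 2 < μ i}).Finite :=
      (hfin _ (half_pos hε)).preimage hinj.injOn
    obtain ⟨N, hN⟩ := hf.exists_notMem
    refine ⟨N, fun n hn => ?_⟩
    have h1 : μ (π N) ≤ ε / 2 := not_lt.1 hN
    have h2 : μ (π n) ≤ μ (π N) := hanti hn
    rw [Real.dist_eq, sub_zero, Function.comp, abs_of_nonneg (hμ _)]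
    linarith
  refine ⟨π, hinj, hanti, htend, fun i hi => le_antisymm ?_ (hμ i)⟩
  -- An index that is never chosen is dominated by every chosen value, and these tend to zero.
  exact ge_of_tendsto htend (Eventually.of_forall fun n =>
    hgmax (P n) i fun h => hi (hPran n i h))

theorem finite_setOf_lt_abs {ξ : ℕ → ℝ} (hξ : Tendsto ξ atTop (𝓝 0)) (ε : ℝ) (hε : 0 < ε) :
    {n | ε < |ξ n|}.Finite := by
  obtain ⟨N, hN⟩ := (Metric.tendsto_atTop.1 hξ) ε hε
  refine (Set.finite_lt_nat N).subset fun n hn => ?_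
  by_contra h
  have := hN n (not_lt.1 h)
  rw [Real.dist_eq, sub_zero] at this
  exact absurd hn (not_lt.2 this.le)

theorem sInf_setOf_pos_and_le {s : ℝ} (hs : 0 ≤ s) : sInf {t : ℝ | 0 < t ∧ s ≤ t} = s := by
  refine le_antisymm (le_of_forall_pos_le_add fun ε hε => ?_)
    (le_csInf ⟨s + 1, by linarith, by linarith⟩ fun t ht => ht.2)
  exact csInf_le ⟨0, fun t ht => ht.1.le⟩ ⟨by linarith, by linarith⟩

/-- For `t > 0` the indices missed by `π` do not count, so the superlevel set of `|ξ|` is the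
`π`-image of an initial segment of ℕ. -/
theorem rearrangement_eq_abs_comp {ξ : ℕ → ℝ} {π : ℕ → ℕ} (hπ : Function.Injective π)
    (hanti : Antitone fun n => |ξ (π n)|) (hz : ∀ k, k ∉ Set.range π → ξ k = 0) :
    rearrangement ξ = fun n => |ξ (π n)| := by
  funext n
  rw [rearrangement, ← sInf_setOf_pos_and_le (abs_nonneg (ξ (π n)))]
  congr 1
  ext t
  refine and_congr_right fun ht => ?_
  have himg : {k | t < |ξ k|} = π '' {m | t < |ξ (π m)|} := by
    ext k
    constructor
    · intro hk
      by_cases hr : k ∈ Set.range π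
      · obtain ⟨m, rfl⟩ := hr
        exact ⟨m, hk, rfl⟩
      · have hk' : t < |ξ k| := hk
        rw [hz k hr, abs_zero] at hk'
        exact absurd hk' (not_lt.2 ht.le)
    · rintro ⟨m, hm, rfl⟩
      exact hm
  rw [himg, hπ.encard_image]
  constructor
  · intro h
    by_contra hlt
    have hsub : (Set.Iio (n + 1)) ⊆ {m | t < |ξ (π m)|} := fun m hm =>
      (not_le.1 hlt).trans_le (hanti (Nat.lt_succ_iff.1 hm))
    have := (Set.encard_le_encard hsub).trans h
    rw [← Finset.coe_Iio, Set.encard_coe_eq_coe_finsetCard, Nat.card_Iio] at this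
    exact absurd (by exact_mod_cast this) (Nat.not_succ_le_self n)
  · intro h
    have hsub : {m | t < |ξ (π m)|} ⊆ Set.Iio n := fun m hm => by
      by_contra hmn
      exact absurd (hm.trans_le ((hanti (not_lt.1 hmn)).trans h)) (lt_irrefl _)
    refine (Set.encard_le_encard hsub).trans ?_
    rw [← Finset.coe_Iio, Set.encard_coe_eq_coe_finsetCard, Nat.card_Iio]

theorem rearrangement_of_antitone {s : ℕ → ℝ} (hs : Antitone s) (h0 : ∀ n, 0 ≤ s n) :
    rearrangement s = s := by
  have habs : (fun n => |s (id n)|) = s := funext fun n => abs_of_nonneg (h0 n)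
  refine (rearrangement_eq_abs_comp Function.injective_id (by rwa [habs]) ?_).trans habs
  simp

theorem exists_injective_rearrangement {ξ : ℕ → ℝ} (hξ : Tendsto ξ atTop (𝓝 0)) :
    ∃ π : ℕ → ℕ, Function.Injective π ∧ (rearrangement ξ = fun n => |ξ (π n)|) ∧
      Antitone (rearrangement ξ) ∧ Tendsto (rearrangement ξ) atTop (𝓝 0) ∧
      ∀ k, k ∉ Set.range π → ξ k = 0 := by
  obtain ⟨π, hπ, hanti, htend, hz⟩ := exists_injective_antitone (fun n => |ξ n|)
    (fun _ => abs_nonneg _) (finite_setOf_lt_abs hξ)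
  have hz' : ∀ k, k ∉ Set.range π → ξ k = 0 := fun k hk => abs_eq_zero.1 (hz k hk)
  have h := rearrangement_eq_abs_comp hπ hanti hz'
  exact ⟨π, hπ, h, h ▸ hanti, h ▸ htend, hz'⟩

open scoped InnerProductSpace InnerProduct

/-! ### Diagonal operators -/

/-- The Hilbert space of square-summable complex sequences. -/
abbrev Ell2 : Type := lp (fun _ : ℕ => ℂ) 2

/-- A bounded real sequence. -/
def BoundedSeq (ξ : ℕ → ℝ) : Prop := ∃ C : ℝ, ∀ n, |ξ n| ≤ C

theorem BoundedSeq.of_tendsto {ξ : ℕ → ℝ} (h : Tendsto ξ atTop (𝓝 0)) : BoundedSeq ξ := by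
  obtain ⟨C, hC⟩ := h.abs.bddAbove_range
  exact ⟨C, fun n => hC ⟨n, rfl⟩⟩

theorem BoundedSeq.mul {ξ η : ℕ → ℝ} (hξ : BoundedSeq ξ) (hη : BoundedSeq η) :
    BoundedSeq (ξ * η) := by
  obtain ⟨C, hC⟩ := hξ
  obtain ⟨D, hD⟩ := hη
  refine ⟨C * D, fun n => ?_⟩
  rw [Pi.mul_apply, abs_mul]
  exact mul_le_mul (hC n) (hD n) (abs_nonneg _) ((abs_nonneg _).trans (hC n))

theorem BoundedSeq.add {ξ η : ℕ → ℝ} (hξ : BoundedSeq ξ) (hη : BoundedSeq η) :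
    BoundedSeq (ξ + η) := by
  obtain ⟨C, hC⟩ := hξ
  obtain ⟨D, hD⟩ := hη
  exact ⟨C + D, fun n => (abs_add_le _ _).trans (add_le_add (hC n) (hD n))⟩

theorem BoundedSeq.comp {ξ : ℕ → ℝ} (hξ : BoundedSeq ξ) (π : ℕ → ℕ) : BoundedSeq (ξ ∘ π) := by
  obtain ⟨C, hC⟩ := hξ
  exact ⟨C, fun n => hC (π n)⟩

theorem boundedSeq_one : BoundedSeq 1 := ⟨1, fun n => by simp⟩

theorem BoundedSeq.memℓp {ξ : ℕ → ℝ} (hξ : BoundedSeq ξ) (f : Ell2) :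
    Memℓp (fun n => (ξ n : ℂ) * f n) 2 := by
  obtain ⟨C, hC⟩ := hξ
  refine Memℓp.mono' (g := fun n => (C : ℂ) • f n) ((lp.memℓp f).const_smul (C : ℂ)) fun n => ?_
  rw [norm_mul, norm_smul, Complex.norm_real, Complex.norm_real, Real.norm_eq_abs,
    Real.norm_eq_abs]
  exact mul_le_mul_of_nonneg_right ((hC n).trans (le_abs_self C)) (norm_nonneg _)

open Classical in
/-- Termwise multiplication by a real sequence (zero if the sequence is unbounded). -/
def mulSeq (ξ : ℕ → ℝ) : Ell2 →L[ℂ] Ell2 :=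
  if h : BoundedSeq ξ then
    LinearMap.mkContinuous
      { toFun := fun f => ⟨fun n => (ξ n : ℂ) * f n, h.memℓp f⟩
        map_add' := fun f g => by ext n; exact mul_add _ _ _
        map_smul' := fun c f => by ext n; simp [mul_left_comm] }
      h.choose (fun f => by
        have h0 : 0 ≤ h.choose := (abs_nonneg _).trans (h.choose_spec 0)
        have h1 : ‖(h.choose : ℂ) • f‖ = h.choose * ‖f‖ := by
          rw [norm_smul, Complex.norm_real, Real.norm_eq_abs, abs_of_nonneg h0]
        rw [← h1]
        refine lp.norm_mono two_ne_zero fun n => ?_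
        simp only [LinearMap.coe_mk, AddHom.coe_mk, lp.coeFn_smul, Pi.smul_apply, norm_smul,
          norm_mul, Complex.norm_real, Real.norm_eq_abs]
        exact mul_le_mul_of_nonneg_right ((h.choose_spec n).trans (le_abs_self _))
          (norm_nonneg _))
  else 0

theorem mulSeq_apply {ξ : ℕ → ℝ} (h : BoundedSeq ξ) (f : Ell2) (n : ℕ) :
    mulSeq ξ f n = (ξ n : ℂ) * f n := by
  rw [mulSeq, dif_pos h]; rfl

theorem norm_mulSeq_le {ξ : ℕ → ℝ} {C : ℝ} (hC : ∀ n, |ξ n| ≤ C) : ‖mulSeq ξ‖ ≤ C := by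
  have h0 : 0 ≤ C := (abs_nonneg _).trans (hC 0)
  refine ContinuousLinearMap.opNorm_le_bound _ h0 fun f => ?_
  have h1 : ‖(C : ℂ) • f‖ = C * ‖f‖ := by
    rw [norm_smul, Complex.norm_real, Real.norm_eq_abs, abs_of_nonneg h0]
  rw [← h1]
  refine lp.norm_mono two_ne_zero fun n => ?_
  rw [mulSeq_apply ⟨C, hC⟩, norm_mul, lp.coeFn_smul, Pi.smul_apply, norm_smul,
    Complex.norm_real, Complex.norm_real, Real.norm_eq_abs, Real.norm_eq_abs]
  exact mul_le_mul_of_nonneg_right ((hC n).trans (le_abs_self C)) (norm_nonneg _)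

theorem mulSeq_comp {ξ η : ℕ → ℝ} (hξ : BoundedSeq ξ) (hη : BoundedSeq η) :
    mulSeq ξ ∘L mulSeq η = mulSeq (ξ * η) := by
  ext f n
  rw [ContinuousLinearMap.comp_apply, mulSeq_apply hξ, mulSeq_apply hη, mulSeq_apply (hξ.mul hη)]
  simp [mul_assoc]

theorem mulSeq_add {ξ η : ℕ → ℝ} (hξ : BoundedSeq ξ) (hη : BoundedSeq η) :
    mulSeq (ξ + η) = mulSeq ξ + mulSeq η := by
  ext f n
  change _ = mulSeq ξ f n + mulSeq η f n
  rw [mulSeq_apply (hξ.add hη), mulSeq_apply hξ, mulSeq_apply hη]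
  simp [add_mul]

theorem adjoint_mulSeq {ξ : ℕ → ℝ} (hξ : BoundedSeq ξ) : (mulSeq ξ)† = mulSeq ξ := by
  symm
  rw [ContinuousLinearMap.eq_adjoint_iff]
  intro f g
  rw [lp.inner_eq_tsum, lp.inner_eq_tsum]
  refine tsum_congr fun n => ?_
  rw [mulSeq_apply hξ, mulSeq_apply hξ]
  simp [mul_assoc, mul_left_comm]

/-- The `n`-th standard unit vector. -/
def unitVec (n : ℕ) : Ell2 := lp.single 2 n 1

theorem inner_unitVec (n : ℕ) (f : Ell2) : ⟪unitVec n, f⟫_ℂ = f n := by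
  rw [unitVec, lp.inner_single_left]; simp

theorem unitVec_apply (n m : ℕ) : unitVec n m = if m = n then 1 else 0 := by
  rw [unitVec, lp.single_apply, Pi.single_apply]

theorem orthonormal_unitVec : Orthonormal ℂ unitVec := by
  rw [orthonormal_iff_ite]
  intro i j
  rw [inner_unitVec, unitVec_apply]

theorem orthonormal_isometry_unitVec {H : Type*} [NormedAddCommGroup H] [InnerProductSpace ℂ H]
    (V : Ell2 →ₗᵢ[ℂ] H) : Orthonormal ℂ fun n => V (unitVec n) :=
  orthonormal_unitVec.comp_linearIsometry V

section Isometries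

variable {H : Type*} [NormedAddCommGroup H] [InnerProductSpace ℂ H] [CompleteSpace H]
variable {K : Type*} [NormedAddCommGroup K] [InnerProductSpace ℂ K] [CompleteSpace K]

theorem _root_.LinearIsometry.adjoint_comp_self_eq_id (V : K →ₗᵢ[ℂ] H) :
    V.toContinuousLinearMap† ∘L V.toContinuousLinearMap = ContinuousLinearMap.id ℂ K :=
  (ContinuousLinearMap.norm_map_iff_adjoint_comp_self _).1 V.norm_map

theorem _root_.LinearIsometry.adjoint_apply_self (V : K →ₗᵢ[ℂ] H) (f : K) :
    (V.toContinuousLinearMap†) (V f) = f :=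
  congrArg (fun T : K →L[ℂ] K => T f) V.adjoint_comp_self_eq_id

theorem _root_.LinearIsometry.norm_toContinuousLinearMap_adjoint_le (V : K →ₗᵢ[ℂ] H) :
    ‖V.toContinuousLinearMap†‖ ≤ 1 := by
  rw [LinearIsometryEquiv.norm_map]
  exact V.norm_toContinuousLinearMap_le

theorem adjoint_apply_coord (V : Ell2 →ₗᵢ[ℂ] H) (v : H) (n : ℕ) :
    ((V.toContinuousLinearMap†) v) n = ⟪V (unitVec n), v⟫_ℂ := by
  rw [← inner_unitVec, ContinuousLinearMap.adjoint_inner_right]; rfl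

/-- The isometry that maps the standard unit vectors to a given orthonormal sequence. -/
def isometryOf {e : ℕ → H} (he : Orthonormal ℂ e) : Ell2 →ₗᵢ[ℂ] H :=
  he.orthogonalFamily.linearIsometry

theorem isometryOf_unitVec {e : ℕ → H} (he : Orthonormal ℂ e) (n : ℕ) :
    isometryOf he (unitVec n) = e n := by
  rw [isometryOf, unitVec, OrthogonalFamily.linearIsometry_apply_single]
  simp

/-- The isometry of `ℓ²` that maps the `n`-th unit vector to the `π n`-th one. -/
def reindex {π : ℕ → ℕ} (hπ : Function.Injective π) : Ell2 →ₗᵢ[ℂ] Ell2 :=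
  isometryOf (orthonormal_unitVec.comp π hπ)

theorem adjoint_reindex_apply {π : ℕ → ℕ} (hπ : Function.Injective π) (f : Ell2) (n : ℕ) :
    (((reindex hπ).toContinuousLinearMap†) f) n = f (π n) := by
  rw [adjoint_apply_coord, reindex, isometryOf_unitVec, Function.comp, inner_unitVec]

/-- `reindex` after its adjoint is the projection onto the sequences supported in the range of `π`.
-/
theorem reindex_adjoint_reindex {π : ℕ → ℕ} (hπ : Function.Injective π) {f : Ell2}
    (hf : ∀ k, k ∉ Set.range π → f k = 0) :
    reindex hπ (((reindex hπ).toContinuousLinearMap†) f) = f := by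
  refine ext_inner_left ℂ fun g => (ContinuousLinearMap.adjoint_inner_left
    (reindex hπ).toContinuousLinearMap _ g).symm.trans ?_
  rw [lp.inner_eq_tsum, lp.inner_eq_tsum]
  simp only [adjoint_reindex_apply]
  exact hπ.tsum_eq (f := fun k => ⟪g k, f k⟫_ℂ) fun k hk => by
    by_contra h
    exact hk (by simp [hf k h])

/-- The operator with matrix `diag ξ` with respect to the orthonormal sequences given by the
isometries `V` (source) and `W` (target). -/
def diag (V W : Ell2 →ₗᵢ[ℂ] H) (ξ : ℕ → ℝ) : H →L[ℂ] H :=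
  W.toContinuousLinearMap ∘L mulSeq ξ ∘L V.toContinuousLinearMap†

theorem diag_apply (V W : Ell2 →ₗᵢ[ℂ] H) (ξ : ℕ → ℝ) (v : H) :
    diag V W ξ v = W (mulSeq ξ ((V.toContinuousLinearMap†) v)) := rfl

theorem diag_mul_diag (U V W : Ell2 →ₗᵢ[ℂ] H) {ξ η : ℕ → ℝ} (hξ : BoundedSeq ξ)
    (hη : BoundedSeq η) : diag V W ξ * diag U V η = diag U W (ξ * η) := by
  ext v
  rw [mul_apply_eq_comp, diag_apply, diag_apply, V.adjoint_apply_self, diag_apply,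
    ← mulSeq_comp hξ hη]
  rfl

theorem diag_one_mul (U V W : Ell2 →ₗᵢ[ℂ] H) {ξ : ℕ → ℝ} (hξ : BoundedSeq ξ) :
    diag V W 1 * diag U V ξ = diag U W ξ := by
  rw [diag_mul_diag U V W boundedSeq_one hξ, one_mul]

theorem diag_mul_one (U V W : Ell2 →ₗᵢ[ℂ] H) {ξ : ℕ → ℝ} (hξ : BoundedSeq ξ) :
    diag V W ξ * diag U V 1 = diag U W ξ := by
  rw [diag_mul_diag U V W hξ boundedSeq_one, mul_one]

theorem diag_add (V W : Ell2 →ₗᵢ[ℂ] H) {ξ η : ℕ → ℝ} (hξ : BoundedSeq ξ) (hη : BoundedSeq η) :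
    diag V W (ξ + η) = diag V W ξ + diag V W η := by
  ext v
  simp [diag_apply, mulSeq_add hξ hη]

theorem norm_diag_le (V W : Ell2 →ₗᵢ[ℂ] H) {ξ : ℕ → ℝ} {C : ℝ} (hC : ∀ n, |ξ n| ≤ C) :
    ‖diag V W ξ‖ ≤ C := by
  have h0 : 0 ≤ C := (abs_nonneg _).trans (hC 0)
  refine ContinuousLinearMap.opNorm_le_bound _ h0 fun v => ?_
  rw [diag_apply, W.norm_map]
  refine (ContinuousLinearMap.le_of_opNorm_le _ (norm_mulSeq_le hC) _).trans ?_
  refine mul_le_mul_of_nonneg_left ?_ h0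
  simpa using ContinuousLinearMap.le_of_opNorm_le _ V.norm_toContinuousLinearMap_adjoint_le v

theorem norm_diag_one_le (V W : Ell2 →ₗᵢ[ℂ] H) : ‖diag V W 1‖ ≤ 1 :=
  norm_diag_le V W fun n => by simp

theorem star_diag (V W : Ell2 →ₗᵢ[ℂ] H) {ξ : ℕ → ℝ} (hξ : BoundedSeq ξ) :
    star (diag V W ξ) = diag W V ξ := by
  rw [ContinuousLinearMap.star_eq_adjoint, diag, ContinuousLinearMap.adjoint_comp,
    ContinuousLinearMap.adjoint_comp, adjoint_mulSeq hξ, ContinuousLinearMap.adjoint_adjoint]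
  rfl

/-- Deleting zero entries and permuting the others is absorbed by the two isometries. This is what
realizes rearrangements, restrictions and shifts of sequences without changing the operator. -/
theorem diag_comp_reindex (V W : Ell2 →ₗᵢ[ℂ] H) {ξ : ℕ → ℝ} (hξ : BoundedSeq ξ) {π : ℕ → ℕ}
    (hπ : Function.Injective π) (hz : ∀ k, k ∉ Set.range π → ξ k = 0) :
    diag (V.comp (reindex hπ)) (W.comp (reindex hπ)) (ξ ∘ π) = diag V W ξ := by
  ext v
  rw [diag_apply, diag_apply, LinearIsometry.coe_comp, Function.comp_apply]
  congr 1
  have hadj : ((V.comp (reindex hπ)).toContinuousLinearMap†) v =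
      ((reindex hπ).toContinuousLinearMap†) ((V.toContinuousLinearMap†) v) := by
    have : (V.comp (reindex hπ)).toContinuousLinearMap =
      V.toContinuousLinearMap ∘L (reindex hπ).toContinuousLinearMap := rfl
    rw [this, ContinuousLinearMap.adjoint_comp]
    rfl
  rw [hadj, ← reindex_adjoint_reindex hπ (f := mulSeq ξ ((V.toContinuousLinearMap†) v))]
  · congr 1
    ext n
    rw [mulSeq_apply (hξ.comp π), adjoint_reindex_apply, adjoint_reindex_apply,
      mulSeq_apply hξ]
    rfl
  · intro k hk
    rw [mulSeq_apply hξ, hz k hk]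
    simp

/-! ### Factorization of operators -/

/-- Douglas' factorization lemma. -/
theorem exists_comp_eq_of_norm_le {E : Type*} [NormedAddCommGroup E] [InnerProductSpace ℂ E]
    (x : E →L[ℂ] H) (y : E →L[ℂ] K) {C : ℝ} (hC : 0 ≤ C) (h : ∀ v, ‖x v‖ ≤ C * ‖y v‖) :
    ∃ u : K →L[ℂ] H, ‖u‖ ≤ C ∧ x = u ∘L y := by
  let M : Submodule ℂ K := (LinearMap.range (y : E →ₗ[ℂ] K)).topologicalClosure
  have hM : IsClosed (M : Set K) := Submodule.isClosed_topologicalClosure _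
  have : CompleteSpace M := hM.completeSpace_coe
  let y' : E →ₗ[ℂ] M := (y : E →ₗ[ℂ] K).codRestrict M fun v =>
    Submodule.le_topologicalClosure _ ⟨v, rfl⟩
  have hd : DenseRange y' := by
    intro z
    rw [closure_subtype]
    have hz : (z : K) ∈ closure ((LinearMap.range (y : E →ₗ[ℂ] K) : Submodule ℂ K) : Set K) := z.2
    convert hz using 2
    ext w
    constructor
    · rintro ⟨_, ⟨v, rfl⟩, rfl⟩
      exact ⟨v, rfl⟩
    · rintro ⟨v, rfl⟩
      exact ⟨y' v, ⟨v, rfl⟩, rfl⟩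
  -- The map `y v ↦ x v` is bounded on the range of `y`; it is extended to the closure by density
  -- and then by zero to the orthogonal complement.
  let g : M →L[ℂ] H := (x : E →ₗ[ℂ] H).extendOfNorm y'
  have hg : ∀ v, g (y' v) = x v := LinearMap.extendOfNorm_eq hd ⟨C, h⟩
  have hgn : ‖g‖ ≤ C := LinearMap.opNorm_extendOfNorm_le hd hC h
  refine ⟨g ∘L M.orthogonalProjectionOnto, ?_, ?_⟩
  · refine (ContinuousLinearMap.opNorm_comp_le _ _).trans ?_
    exact (mul_le_mul hgn M.orthogonalProjectionOnto_norm_le (by positivity) hC).trans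
      (mul_one C).le
  · ext v
    have : M.orthogonalProjectionOnto (y v) = y' v :=
      Submodule.orthogonalProjectionOnto_mem_subspace_eq_self (y' v)
    rw [ContinuousLinearMap.comp_apply, ContinuousLinearMap.comp_apply, this, hg]

end Isometries

open scoped ComplexOrder

/-! ### Schmidt expansions of compact operators -/

section Schmidt

variable {H : Type*} [NormedAddCommGroup H] [InnerProductSpace ℂ H]

theorem _root_.HilbertBasis.infinite_index {ι : Type*} (b : HilbertBasis ι ℂ H)
    (hH : ¬ FiniteDimensional ℂ H) : Infinite ι := by
  by_contra h
  have := not_infinite_iff_finite.1 h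
  have := Fintype.ofFinite ι
  exact hH b.toOrthonormalBasis.toBasis.finiteDimensional_of_finite

/-- Infinitely many such eigenvectors would have images at mutual distance greater than `ε` (pair
the difference with one of the two eigenvectors), hence no Cauchy subsequence. -/
theorem eigenvalue_gt_finite {ι : Type*} {T : H →L[ℂ] H} (hT : IsCompactOperator T)
    {b : ι → H} (hb : Orthonormal ℂ b) {m : ι → ℝ} (hm : ∀ i, T (b i) = (m i : ℂ) • b i)
    {ε : ℝ} (hε : 0 < ε) : {i | ε < m i}.Finite := by
  by_contra hinf
  have := Set.infinite_coe_iff.2 hinf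
  let f := Infinite.natEmbedding {i | ε < m i}
  obtain ⟨K, hK, hTK⟩ := hT.image_closedBall_subset_compact (f := (T : H →ₗ[ℂ] H)) 1
  have hmem : ∀ n, T (b (f n)) ∈ K := fun n =>
    hTK ⟨b (f n), by simp [hb.norm_eq_one], rfl⟩
  obtain ⟨x, -, φ, hφ, hx⟩ := hK.tendsto_subseq hmem
  obtain ⟨N, hN⟩ := (Metric.cauchySeq_iff.1 hx.cauchySeq) ε hε
  have hd := hN N le_rfl (N + 1) N.le_succ
  have hne : ((f (φ N) : {i | ε < m i}) : ι) ≠ f (φ (N + 1)) := fun h =>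
    (hφ N.lt_succ_self).ne (f.injective (Subtype.ext h))
  have h1 : ⟪b (f (φ N)), T (b (f (φ N))) - T (b (f (φ (N + 1))))⟫_ℂ = m (f (φ N)) := by
    rw [inner_sub_right, hm, hm, inner_smul_right, inner_smul_right, hb.inner_eq_zero hne,
      inner_self_eq_norm_sq_to_K, hb.norm_eq_one]
    simp
  have h2 := norm_inner_le_norm (𝕜 := ℂ) (b (f (φ N)))
    (T (b (f (φ N))) - T (b (f (φ (N + 1)))))
  rw [h1, hb.norm_eq_one, one_mul, ← dist_eq_norm, Complex.norm_real, Real.norm_eq_abs] at h2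
  have h3 : ε < m (f (φ N)) := (f (φ N)).2
  have h4 := le_abs_self (m (f (φ N)))
  have h5 : dist (T (b (f (φ N)))) (T (b (f (φ (N + 1))))) < ε := hd
  linarith

variable [CompleteSpace H]

theorem exists_isometry (hH : ¬ FiniteDimensional ℂ H) : Nonempty (Ell2 →ₗᵢ[ℂ] H) := by
  obtain ⟨w, b, -⟩ := exists_hilbertBasis ℂ H
  have := b.infinite_index hH
  exact ⟨isometryOf (b.orthonormal.comp _ (Infinite.natEmbedding w).injective)⟩

/-- A compact self-adjoint operator has a Hilbert basis of eigenvectors. -/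
theorem exists_hilbertBasis_eigenvectors.{u} {H : Type u} [NormedAddCommGroup H]
    [InnerProductSpace ℂ H] [CompleteSpace H] {T : H →L[ℂ] H} (hT : IsCompactOperator T)
    (hs : (T : H →ₗ[ℂ] H).IsSymmetric) :
    ∃ (ι : Type u) (b : HilbertBasis ι ℂ H) (m : ι → ℂ), ∀ i, T (b i) = m i • b i := by
  let G : ℂ → Submodule ℂ H := fun μ => Module.End.eigenspace (T : H →ₗ[ℂ] H) μ
  have hG : ∀ μ, IsClosed (G μ : Set H) := fun μ => by
    have : (G μ : Set H) = {v | T v = μ • v} := by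
      ext v; exact Module.End.mem_eigenspace_iff
    rw [this]
    exact isClosed_eq T.continuous (continuous_const_smul μ)
  have hc : ∀ μ, CompleteSpace (G μ) := fun μ => (hG μ).completeSpace_coe
  choose w b hb using fun μ => exists_hilbertBasis ℂ (G μ)
  have hfam : OrthogonalFamily ℂ (fun μ => G μ) fun μ => (G μ).subtypeₗᵢ :=
    hs.orthogonalFamily_eigenspaces
  have hon : Orthonormal ℂ (fun a : Σ μ, w μ => (G a.1).subtypeₗᵢ (b a.1 a.2)) :=
    hfam.orthonormal_sigma_orthonormal fun μ => (b μ).orthonormal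
  have hperp : (Submodule.span ℂ (Set.range
      fun a : Σ μ, w μ => (G a.1).subtypeₗᵢ (b a.1 a.2)))ᗮ = ⊥ := by
    rw [eq_bot_iff, ← ContinuousLinearMap.orthogonalComplement_iSup_eigenspaces_eq_bot hT hs]
    intro v hv
    rw [Submodule.mem_orthogonal'] at hv
    rw [← Submodule.iInf_orthogonal, Submodule.mem_iInf]
    intro μ
    rw [Submodule.mem_orthogonal']
    intro u hu
    -- Orthogonality to the chosen bases passes to every eigenvector `u` by expanding `u` in the
    -- basis of its eigenspace.
    have hsum := (b μ).hasSum_repr ⟨u, hu⟩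
    have hsum' := ((G μ).subtypeL.hasSum hsum).mapL (innerSL ℂ v)
    refine hsum'.unique ?_
    convert hasSum_zero with i
    have := hv _ (Submodule.subset_span ⟨⟨μ, i⟩, rfl⟩)
    simp only [map_smul]
    exact (congrArg _ this).trans (smul_zero _)
  refine ⟨Σ μ, w μ, HilbertBasis.mkOfOrthogonalEqBot hon hperp, fun a => a.1, fun a => ?_⟩
  rw [HilbertBasis.coe_mkOfOrthogonalEqBot]
  exact Module.End.mem_eigenspace_iff.1 (b a.1 a.2).2

/-- A positive compact operator is diagonal with decreasing nonnegative null eigenvalues. -/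
theorem exists_eq_diag_of_nonneg (hH : ¬ FiniteDimensional ℂ H) {T : H →L[ℂ] H}
    (hT : IsCompactOperator T) (hpos : 0 ≤ T) :
    ∃ (V : Ell2 →ₗᵢ[ℂ] H) (s : ℕ → ℝ), Antitone s ∧ (∀ n, 0 ≤ s n) ∧ Tendsto s atTop (𝓝 0) ∧
      T = diag V V s := by
  have hP : T.IsPositive := (ContinuousLinearMap.nonneg_iff_isPositive T).1 hpos
  obtain ⟨ι, b, m, hm⟩ := exists_hilbertBasis_eigenvectors hT hP.isSymmetric
  have hm0 : ∀ i, 0 ≤ m i := fun i => by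
    have := hP.inner_nonneg_right (b i)
    rwa [hm, inner_smul_right, inner_self_eq_norm_sq_to_K, b.orthonormal.norm_eq_one,
      RCLike.ofReal_one, one_pow, mul_one] at this
  have hre : ∀ i, m i = ((m i).re : ℂ) := fun i => by
    apply Complex.ext
    · simp
    · simpa using (Complex.le_def.1 (hm0 i)).2.symm
  have hm' : ∀ i, T (b i) = ((m i).re : ℂ) • b i := fun i => by rw [← hre, hm]
  have := b.infinite_index hH
  obtain ⟨π, hπ, hanti, htend, hz⟩ := exists_injective_antitone (fun i => (m i).re)
    (fun i => (Complex.le_def.1 (hm0 i)).1)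
    (fun ε hε => eigenvalue_gt_finite hT b.orthonormal hm' hε)
  have hon := b.orthonormal.comp π hπ
  refine ⟨isometryOf hon, _, hanti, fun n => (Complex.le_def.1 (hm0 _)).1, htend, ?_⟩
  have hbd := BoundedSeq.of_tendsto htend
  ext v
  apply b.repr.injective
  ext i
  rw [b.repr_apply_apply, b.repr_apply_apply]
  have h1 : ⟪b i, T v⟫_ℂ = (m i).re * ⟪b i, v⟫_ℂ := by
    refine (hP.isSymmetric (b i) v).symm.trans ?_
    rw [ContinuousLinearMap.coe_coe, hm', inner_smul_left, Complex.conj_ofReal]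
  rw [h1, diag_apply]
  -- Coordinates along `b` are compared: those enumerated by `π` agree by construction, and the
  -- others belong to the eigenvalue zero.
  by_cases hi : i ∈ Set.range π
  · obtain ⟨n, rfl⟩ := hi
    have h2 : b (π n) = isometryOf hon (unitVec n) := (isometryOf_unitVec hon n).symm
    conv_rhs => rw [h2, LinearIsometry.inner_map_map, inner_unitVec, mulSeq_apply hbd,
      adjoint_apply_coord, ← h2]
    rfl
  · have h2 : ((isometryOf hon).toContinuousLinearMap†) (b i) = 0 := by
      ext n
      rw [adjoint_apply_coord, isometryOf_unitVec]
      exact b.orthonormal.inner_eq_zero fun h => hi ⟨n, h⟩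
    rw [hz i hi, Complex.ofReal_zero, zero_mul]
    refine (Eq.trans (ContinuousLinearMap.adjoint_inner_left
      (isometryOf hon).toContinuousLinearMap _ (b i)).symm ?_).symm
    rw [h2, inner_zero_left]

theorem norm_abs_apply (x : H →L[ℂ] H) (v : H) : ‖(CFC.abs x : H →L[ℂ] H) v‖ = ‖x v‖ := by
  have hsa : IsSelfAdjoint (CFC.abs x : H →L[ℂ] H) := (CFC.abs_nonneg x).isSelfAdjoint
  have h := CFC.abs_mul_abs x
  have h1 : ‖(CFC.abs x : H →L[ℂ] H) v‖ ^ 2 = ‖x v‖ ^ 2 := by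
    rw [ContinuousLinearMap.apply_norm_sq_eq_inner_adjoint_left,
      ContinuousLinearMap.apply_norm_sq_eq_inner_adjoint_left x,
      ← ContinuousLinearMap.star_eq_adjoint, ← ContinuousLinearMap.star_eq_adjoint,
      hsa.star_eq]
    congr 2
    exact congrArg (fun S : H →L[ℂ] H => S v) h
  exact (sq_eq_sq₀ (norm_nonneg _) (norm_nonneg _)).1 h1

/-- With its companion below, this replaces the polar decomposition. Contractive factors suffice,
since they are used only for inequalities in symmetric ideals. -/
theorem exists_eq_mul_abs (x : H →L[ℂ] H) :
    ∃ u : H →L[ℂ] H, ‖u‖ ≤ 1 ∧ x = u * CFC.abs x :=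
  exists_comp_eq_of_norm_le x (CFC.abs x) zero_le_one fun v => by rw [norm_abs_apply, one_mul]

theorem exists_abs_eq_mul (x : H →L[ℂ] H) :
    ∃ u : H →L[ℂ] H, ‖u‖ ≤ 1 ∧ CFC.abs x = u * x :=
  exists_comp_eq_of_norm_le (CFC.abs x) x zero_le_one fun v => by rw [norm_abs_apply, one_mul]

/-- `s` is the sequence of coefficients in a Schmidt expansion of `x`: it is a decreasing
nonnegative null sequence, and `|x|` is diagonal with entries `s`. -/
structure IsSchmidt (x : H →L[ℂ] H) (s : ℕ → ℝ) : Prop where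
  antitone : Antitone s
  nonneg : ∀ n, 0 ≤ s n
  tendsto : Tendsto s atTop (𝓝 0)
  exists_diag : ∃ V : Ell2 →ₗᵢ[ℂ] H, CFC.abs x = diag V V s

theorem IsSchmidt.boundedSeq {x : H →L[ℂ] H} {s : ℕ → ℝ} (h : IsSchmidt x s) : BoundedSeq s :=
  BoundedSeq.of_tendsto h.tendsto

theorem exists_isSchmidt (hH : ¬ FiniteDimensional ℂ H) {x : H →L[ℂ] H}
    (hx : IsCompactOperator x) : ∃ s, IsSchmidt x s := by
  obtain ⟨u, -, hu⟩ := exists_abs_eq_mul x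
  have hc : IsCompactOperator (CFC.abs x : H →L[ℂ] H) := by
    rw [hu]; exact hx.clm_comp u
  obtain ⟨V, s, h1, h2, h3, h4⟩ := exists_eq_diag_of_nonneg hH hc (CFC.abs_nonneg x)
  exact ⟨s, h1, h2, h3, V, h4⟩

/-- Uniqueness of the positive square root: both sides have square `diag V V (ξ * ξ)`, and the right
side is positive as the square of the diagonal operator with entries `√|ξ n|`. -/
theorem abs_diag (V W : Ell2 →ₗᵢ[ℂ] H) {ξ : ℕ → ℝ} (hξ : BoundedSeq ξ) :
    CFC.abs (diag V W ξ) = diag V V fun n => |ξ n| := by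
  have hb : BoundedSeq fun n => |ξ n| := by
    obtain ⟨C, hC⟩ := hξ
    exact ⟨C, fun n => by simpa using hC n⟩
  have hr : BoundedSeq fun n => √|ξ n| := by
    obtain ⟨C, hC⟩ := hξ
    refine ⟨√C, fun n => ?_⟩
    rw [abs_of_nonneg (Real.sqrt_nonneg _)]
    exact Real.sqrt_le_sqrt (hC n)
  refine CFC.sqrt_unique ?_ ?_
  · rw [star_diag V W hξ, diag_mul_diag _ _ _ hξ hξ, diag_mul_diag _ _ _ hb hb]
    congr 1
    funext n
    exact abs_mul_abs_self _
  · have : diag V V (fun n => |ξ n|) =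
        star (diag V V fun n => √|ξ n|) * diag V V fun n => √|ξ n| := by
      rw [star_diag _ _ hr, diag_mul_diag _ _ _ hr hr]
      congr 1
      funext n
      exact (Real.mul_self_sqrt (abs_nonneg _)).symm
    rw [this]
    exact star_mul_self_nonneg _

theorem isSchmidt_diag (V W : Ell2 →ₗᵢ[ℂ] H) {ξ : ℕ → ℝ} (hξ : Tendsto ξ atTop (𝓝 0)) :
    IsSchmidt (diag V W ξ) (rearrangement ξ) := by
  obtain ⟨π, hπ, heq, hanti, htend, hz⟩ := exists_injective_rearrangement hξ
  refine ⟨hanti, fun n => by rw [heq]; exact abs_nonneg _, htend, V.comp (reindex hπ), ?_⟩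
  have hb : BoundedSeq fun n => |ξ n| := by
    obtain ⟨C, hC⟩ := BoundedSeq.of_tendsto hξ
    exact ⟨C, fun n => by simpa using hC n⟩
  rw [abs_diag V W (BoundedSeq.of_tendsto hξ), heq,
    ← diag_comp_reindex V V hb hπ fun k hk => by rw [hz k hk, abs_zero]]
  rfl

/-! ### Singular values -/

theorem eq_sum_unitVec {f : Ell2} {n : ℕ} (hf : ∀ i, n ≤ i → f i = 0) :
    f = ∑ i ∈ Finset.range n, f i • unitVec i := by
  ext k
  rw [lp.coeFn_sum, Finset.sum_apply]
  simp only [lp.coeFn_smul, Pi.smul_apply, unitVec_apply, smul_eq_mul, mul_ite, mul_one, mul_zero,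
    Finset.sum_ite_eq, Finset.mem_range]
  split_ifs with h
  · rfl
  · exact hf k (not_lt.1 h)

theorem diag_unitVec (V W : Ell2 →ₗᵢ[ℂ] H) {ξ : ℕ → ℝ} (hξ : BoundedSeq ξ) (n : ℕ) :
    diag V W ξ (V (unitVec n)) = (ξ n : ℂ) • W (unitVec n) := by
  rw [diag_apply, V.adjoint_apply_self, ← map_smul]
  congr 1
  ext k
  rw [mulSeq_apply hξ, lp.coeFn_smul, Pi.smul_apply, unitVec_apply]
  split_ifs with h
  · rw [h]; rfl
  · simp

/-- For `t > 0`, the space `eigenspacesAbove x t` contains `n + 1` orthonormal vectors if `t < s n`,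
and lies in the span of `n` vectors if `s n ≤ t`. -/
theorem IsSchmidt.singularValue_eq {x : H →L[ℂ] H} {s : ℕ → ℝ} (h : IsSchmidt x s) :
    singularValue x = s := by
  obtain ⟨V, hV⟩ := h.exists_diag
  funext n
  rw [singularValue, ← sInf_setOf_pos_and_le (h.nonneg n)]
  congr 1
  ext t
  refine and_congr_right fun ht => ⟨fun hr => ?_, fun hs => ?_⟩
  · by_contra hlt
    rw [not_le] at hlt
    have hmem : ∀ i : Fin (n + 1), V (unitVec i) ∈ eigenspacesAbove x t := by
      intro i
      have hi : t < s i := hlt.trans_le (h.antitone (Nat.lt_succ_iff.1 i.2))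
      refine Submodule.mem_iSup_of_mem (s i) (Submodule.mem_iSup_of_mem hi ?_)
      rw [Module.End.mem_eigenspace_iff, hV]
      exact diag_unitVec V V h.boundedSeq i
    have hli : LinearIndependent ℂ fun i : Fin (n + 1) =>
        (⟨V (unitVec i), hmem i⟩ : eigenspacesAbove x t) := by
      refine LinearIndependent.of_comp (eigenspacesAbove x t).subtype ?_
      exact ((orthonormal_isometry_unitVec V).comp _ Fin.val_injective).linearIndependent
    have hc := hli.cardinal_lift_le_rank
    rw [Cardinal.mk_fin, Cardinal.lift_natCast, ← Cardinal.lift_natCast.{0}, Cardinal.lift_le] at hc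
    exact absurd (Nat.cast_le.1 (hc.trans hr)) (Nat.not_succ_le_self n)
  · classical
    have hsub : eigenspacesAbove x t ≤
        Submodule.span ℂ ((Finset.range n).image fun i => V (unitVec i) : Finset H) := by
      refine iSup_le fun r => iSup_le fun hr => ?_
      intro v hv
      rw [Module.End.mem_eigenspace_iff, hV] at hv
      have hv : diag V V s v = (r : ℂ) • v := hv
      have hr0 : (r : ℂ) ≠ 0 := by exact_mod_cast (ht.trans hr).ne'
      set c := (V.toContinuousLinearMap†) v with hc
      have h1 : mulSeq s c = (r : ℂ) • c := by
        have := congrArg (V.toContinuousLinearMap†) hv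
        rwa [diag_apply, V.adjoint_apply_self, map_smul] at this
      -- Coordinatewise `(s i - r) * c i = 0`, while `s i ≤ s n ≤ t < r`.
      have h2 : ∀ i, n ≤ i → c i = 0 := by
        intro i hi
        have h3 : (s i : ℂ) * c i = r * c i := by
          rw [← mulSeq_apply h.boundedSeq, h1]; rfl
        have h4 : ((s i - r : ℝ) : ℂ) * c i = 0 := by
          push_cast; rw [sub_mul, h3, sub_self]
        refine (mul_eq_zero.1 h4).resolve_left ?_
        have : s i - r < 0 := by linarith [h.antitone hi]
        exact_mod_cast this.ne
      have h5 : v = V c := by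
        rw [diag_apply, h1, map_smul] at hv
        exact (smul_right_injective H hr0 hv).symm
      rw [h5, eq_sum_unitVec h2, map_sum]
      refine Submodule.sum_mem _ fun i hi => ?_
      rw [map_smul]
      refine Submodule.smul_mem _ _ (Submodule.subset_span ?_)
      exact Finset.mem_coe.2 (Finset.mem_image_of_mem _ hi)
    refine (Submodule.rank_mono hsub).trans ((rank_span_finset_le _).trans ?_)
    exact_mod_cast Finset.card_image_le.trans (Finset.card_range n).le

theorem singularValue_diag (V W : Ell2 →ₗᵢ[ℂ] H) {ξ : ℕ → ℝ} (hξ : Tendsto ξ atTop (𝓝 0)) :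
    singularValue (diag V W ξ) = rearrangement ξ :=
  (isSchmidt_diag V W hξ).singularValue_eq

theorem isSchmidt_singularValue (hH : ¬ FiniteDimensional ℂ H) {x : H →L[ℂ] H}
    (hx : IsCompactOperator x) : IsSchmidt x (singularValue x) := by
  obtain ⟨s, hs⟩ := exists_isSchmidt hH hx
  rwa [hs.singularValue_eq]

/-- The isometries `V` and `W` are arbitrary, because diagonal partial isometries `diag _ _ 1` move
`s` from one pair of orthonormal sequences to another. Together with the next lemma, this makes `x`
and `diag V W s` interchangeable in a symmetric ideal. -/
theorem IsSchmidt.exists_eq_mul_diag_mul {x : H →L[ℂ] H} {s : ℕ → ℝ} (h : IsSchmidt x s)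
    (V W : Ell2 →ₗᵢ[ℂ] H) :
    ∃ a b : H →L[ℂ] H, ‖a‖ ≤ 1 ∧ ‖b‖ ≤ 1 ∧ x = a * diag V W s * b := by
  obtain ⟨U, hU⟩ := h.exists_diag
  obtain ⟨u, hu, hux⟩ := exists_eq_mul_abs x
  refine ⟨u * diag W U 1, diag U V 1, ?_, norm_diag_one_le _ _, ?_⟩
  · exact (norm_mul_le _ _).trans (mul_le_one₀ hu (norm_nonneg _) (norm_diag_one_le _ _))
  · rw [mul_assoc, mul_assoc, diag_mul_one _ _ _ h.boundedSeq, diag_one_mul _ _ _ h.boundedSeq,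
      ← hU, ← hux]

theorem IsSchmidt.exists_diag_eq_mul_mul {x : H →L[ℂ] H} {s : ℕ → ℝ} (h : IsSchmidt x s)
    (V W : Ell2 →ₗᵢ[ℂ] H) :
    ∃ a b : H →L[ℂ] H, ‖a‖ ≤ 1 ∧ ‖b‖ ≤ 1 ∧ diag V W s = a * x * b := by
  obtain ⟨U, hU⟩ := h.exists_diag
  obtain ⟨u, hu, hux⟩ := exists_abs_eq_mul x
  refine ⟨diag U W 1 * u, diag V U 1, ?_, norm_diag_one_le _ _, ?_⟩
  · exact (norm_mul_le _ _).trans (mul_le_one₀ (norm_diag_one_le _ _) (norm_nonneg _) hu)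
  · rw [mul_assoc _ u, ← hux, hU, diag_one_mul _ _ _ h.boundedSeq, diag_mul_one _ _ _ h.boundedSeq]

theorem norm_mulSeq_apply_le {s : ℕ → ℝ} (hs : Antitone s) (h0 : ∀ n, 0 ≤ s n) {n : ℕ} {f : Ell2}
    (hf : ∀ i < n, f i = 0) : ‖mulSeq s f‖ ≤ s n * ‖f‖ := by
  have hb : BoundedSeq s := ⟨s 0, fun k => by rw [abs_of_nonneg (h0 k)]; exact hs (Nat.zero_le k)⟩
  have h1 : ‖(s n : ℂ) • f‖ = s n * ‖f‖ := by
    rw [norm_smul, Complex.norm_real, Real.norm_eq_abs, abs_of_nonneg (h0 n)]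
  rw [← h1]
  refine lp.norm_mono two_ne_zero fun i => ?_
  rw [mulSeq_apply hb, lp.coeFn_smul, Pi.smul_apply, smul_eq_mul, norm_mul, norm_mul,
    Complex.norm_real, Complex.norm_real, Real.norm_eq_abs, Real.norm_eq_abs,
    abs_of_nonneg (h0 _), abs_of_nonneg (h0 _)]
  rcases lt_or_ge i n with hi | hi
  · simp [hf i hi]
  · exact mul_le_mul_of_nonneg_right (hs hi) (norm_nonneg _)

theorem le_norm_mulSeq_apply {s : ℕ → ℝ} (hs : Antitone s) (h0 : ∀ n, 0 ≤ s n) {n : ℕ} {f : Ell2}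
    (hf : ∀ i, n < i → f i = 0) : s n * ‖f‖ ≤ ‖mulSeq s f‖ := by
  have hb : BoundedSeq s := ⟨s 0, fun k => by rw [abs_of_nonneg (h0 k)]; exact hs (Nat.zero_le k)⟩
  have h1 : ‖(s n : ℂ) • f‖ = s n * ‖f‖ := by
    rw [norm_smul, Complex.norm_real, Real.norm_eq_abs, abs_of_nonneg (h0 n)]
  rw [← h1]
  refine lp.norm_mono two_ne_zero fun i => ?_
  rw [mulSeq_apply hb, lp.coeFn_smul, Pi.smul_apply, smul_eq_mul, norm_mul, norm_mul,
    Complex.norm_real, Complex.norm_real, Real.norm_eq_abs, Real.norm_eq_abs,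
    abs_of_nonneg (h0 _), abs_of_nonneg (h0 _)]
  rcases lt_or_ge n i with hi | hi
  · simp [hf i hi]
  · exact mul_le_mul_of_nonneg_right (hs hi) (norm_nonneg _)

/-- A dimension count. The span of the first `2n + 1` Schmidt vectors of `a * x` contains a nonzero
`v` satisfying `2n` linear conditions: `v` is orthogonal to the first `n` Schmidt vectors of `x`,
and `x v` to the first `n` of `a`. Then `‖x v‖ ≤ t n * ‖v‖` and `‖a (x v)‖ ≤ s n * ‖x v‖`, while `‖a
(x v)‖ ≥ r (2 * n) * ‖v‖`. -/
theorem IsSchmidt.mul_le {a x : H →L[ℂ] H} {r s t : ℕ → ℝ} (hax : IsSchmidt (a * x) r)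
    (ha : IsSchmidt a s) (hx : IsSchmidt x t) (n : ℕ) : r (2 * n) ≤ s n * t n := by
  obtain ⟨U, hU⟩ := hax.exists_diag
  obtain ⟨V, hV⟩ := ha.exists_diag
  obtain ⟨W, hW⟩ := hx.exists_diag
  let F : (Fin (2 * n + 1) → ℂ) →ₗ[ℂ] H := Fintype.linearCombination ℂ fun i => U (unitVec i)
  let L : H →ₗ[ℂ] (Fin n → ℂ) × (Fin n → ℂ) :=
    (LinearMap.pi fun i : Fin n => ((innerSL ℂ (V (unitVec i)) ∘L x : H →L[ℂ] ℂ) : H →ₗ[ℂ] ℂ)).prod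
      (LinearMap.pi fun i : Fin n => ((innerSL ℂ (W (unitVec i)) : H →L[ℂ] ℂ) : H →ₗ[ℂ] ℂ))
  obtain ⟨c, hc, hc0⟩ := (Submodule.ne_bot_iff _).1 (LinearMap.ker_ne_bot_of_finrank_lt
    (f := L ∘ₗ F) (by simp; omega))
  let v := F c
  have hv0 : v ≠ 0 := fun h => hc0 <| funext <| Fintype.linearIndependent_iff.1
    ((orthonormal_isometry_unitVec U).comp _ Fin.val_injective).linearIndependent c h
  have hL : L v = 0 := hc
  have hL1 : ∀ i < n, ⟪V (unitVec i), x v⟫_ℂ = 0 := fun i hi =>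
    congrFun (congrArg Prod.fst hL) ⟨i, hi⟩
  have hL2 : ∀ i < n, ⟪W (unitVec i), v⟫_ℂ = 0 := fun i hi =>
    congrFun (congrArg Prod.snd hL) ⟨i, hi⟩
  have hnorm : ∀ (y : H →L[ℂ] H) (u : H) (Z : Ell2 →ₗᵢ[ℂ] H) (ζ : ℕ → ℝ),
      CFC.abs y = diag Z Z ζ → ‖y u‖ = ‖mulSeq ζ ((Z.toContinuousLinearMap†) u)‖ := by
    intro y u Z ζ hy
    rw [← norm_abs_apply, hy, diag_apply, Z.norm_map]
  have hadj : ∀ (Z : Ell2 →ₗᵢ[ℂ] H) (u : H), ‖(Z.toContinuousLinearMap†) u‖ ≤ ‖u‖ := fun Z u => by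
    simpa using ContinuousLinearMap.le_of_opNorm_le _ Z.norm_toContinuousLinearMap_adjoint_le u
  have hxv : ‖x v‖ ≤ t n * ‖v‖ := by
    rw [hnorm x v W t hW]
    refine (norm_mulSeq_apply_le hx.antitone hx.nonneg fun i hi => ?_).trans
      (mul_le_mul_of_nonneg_left (hadj W v) (hx.nonneg n))
    rw [adjoint_apply_coord, hL2 i hi]
  have haxv : ‖a (x v)‖ ≤ s n * ‖x v‖ := by
    rw [hnorm a (x v) V s hV]
    refine (norm_mulSeq_apply_le ha.antitone ha.nonneg fun i hi => ?_).trans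
      (mul_le_mul_of_nonneg_left (hadj V _) (ha.nonneg n))
    rw [adjoint_apply_coord, hL1 i hi]
  let f : Ell2 := ∑ i, c i • unitVec i
  have hvf : v = U f := by
    simp only [v, F, f, Fintype.linearCombination_apply, map_sum, map_smul]
  have hlow : r (2 * n) * ‖v‖ ≤ ‖(a * x) v‖ := by
    rw [hnorm (a * x) v U r hU, hvf, U.adjoint_apply_self, U.norm_map]
    refine le_norm_mulSeq_apply hax.antitone hax.nonneg fun i hi => ?_
    simp only [f]
    rw [lp.coeFn_sum, Finset.sum_apply]
    refine Finset.sum_eq_zero fun j _ => ?_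
    rw [lp.coeFn_smul, Pi.smul_apply, unitVec_apply, if_neg (by omega), smul_zero]
  have hvpos : 0 < ‖v‖ := norm_pos_iff.2 hv0
  refine le_of_mul_le_mul_right ?_ hvpos
  calc r (2 * n) * ‖v‖ ≤ ‖a (x v)‖ := hlow
    _ ≤ s n * (t n * ‖v‖) := haxv.trans (mul_le_mul_of_nonneg_left hxv (ha.nonneg n))
    _ = s n * t n * ‖v‖ := (mul_assoc _ _ _).symm

end Schmidt

/-! ### Noncompact operators -/

section NonCompact

variable {H : Type*} [NormedAddCommGroup H] [InnerProductSpace ℂ H]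

theorem clm_ext_unitVec {x y : Ell2 →L[ℂ] H} (h : ∀ n, x (unitVec n) = y (unitVec n)) : x = y := by
  ext f
  have hf := lp.hasSum_single (p := 2) (by norm_num) f
  have hs : ∀ n, lp.single 2 n (f n) = f n • unitVec n := fun n => by
    rw [unitVec, ← lp.single_smul, smul_eq_mul, mul_one]
  simp only [hs] at hf
  refine (hf.mapL x).unique ?_
  convert hf.mapL y using 2 with n
  rw [map_smul, map_smul, h]

variable [CompleteSpace H]

/-- Otherwise, for each `ε`, the operator `a` is small on the complement of some finite-dimensional
`F`, so it is within `ε` of the finite-rank operator `a P_F`; compact operators form a closed set.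
-/
theorem exists_unit_orthogonal_of_not_compact {a : H →L[ℂ] H} (ha : ¬ IsCompactOperator a) :
    ∃ δ > 0, ∀ F : Submodule ℂ H, FiniteDimensional ℂ F → ∃ v ∈ Fᗮ, ‖v‖ = 1 ∧ δ ≤ ‖a v‖ := by
  by_contra! hcon
  apply ha
  have hcl : IsClosed {x : H →L[ℂ] H | IsCompactOperator x} := isClosed_setOfPred_isCompactOperator
  refine hcl.closure_subset (Metric.mem_closure_iff.2 fun ε hε => ?_)
  obtain ⟨F, hF, hlt⟩ := hcon (ε / 2) (half_pos hε)
  have : ProperSpace F := FiniteDimensional.proper ℂ F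
  have hPc : IsCompactOperator F.orthogonalProjectionOnto :=
    isCompactOperator_of_locallyCompactSpace_dom _
  refine ⟨a ∘L F.subtypeL ∘L F.orthogonalProjectionOnto, ?_, ?_⟩
  · exact (hPc.clm_comp F.subtypeL).clm_comp a
  · rw [dist_eq_norm]
    refine lt_of_le_of_lt (ContinuousLinearMap.opNorm_le_bound _ (half_pos hε).le fun w => ?_)
      (half_lt_self hε)
    set u := w - F.starProjection w with hu
    have hw : (a - a ∘L F.subtypeL ∘L F.orthogonalProjectionOnto) w = a u := by
      rw [hu, map_sub]; rfl
    have hum : u ∈ Fᗮ := F.sub_starProjection_mem_orthogonal w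
    have hun : ‖u‖ ≤ ‖w‖ := by
      rw [hu, ← Submodule.starProjection_orthogonal_val]
      exact Submodule.norm_starProjection_apply_le _ _
    rw [hw]
    refine le_trans ?_ (mul_le_mul_of_nonneg_left hun (half_pos hε).le)
    rcases eq_or_ne u 0 with h0 | h0
    · simp [h0]
    · have hpos : 0 < ‖u‖ := norm_pos_iff.2 h0
      have h1 := hlt (((‖u‖⁻¹ : ℝ) : ℂ) • u) (Submodule.smul_mem _ _ hum) (by
        rw [norm_smul, Complex.norm_real, norm_inv, norm_norm, inv_mul_cancel₀ hpos.ne'])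
      rw [map_smul, norm_smul, Complex.norm_real, norm_inv, norm_norm,
        inv_mul_lt_iff₀ hpos] at h1
      linarith

/-- A noncompact operator is left invertible on some infinite-dimensional closed subspace. -/
theorem exists_left_inverse_on_of_not_compact {a : H →L[ℂ] H} (ha : ¬ IsCompactOperator a) :
    ∃ (V : Ell2 →ₗᵢ[ℂ] H) (u : H →L[ℂ] H),
      V.toContinuousLinearMap = u ∘L a ∘L V.toContinuousLinearMap := by
  obtain ⟨δ, hδ, hex⟩ := exists_unit_orthogonal_of_not_compact ha
  choose g hg using fun F : {F : Submodule ℂ H // FiniteDimensional ℂ F} => hex F.1 F.2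
  -- Adjoining `a† a e` along with `e` makes the later vectors orthogonal to `e` and their images
  -- orthogonal to `a e`.
  let next : {F : Submodule ℂ H // FiniteDimensional ℂ F} →
      {F : Submodule ℂ H // FiniteDimensional ℂ F} := fun F =>
    ⟨F.1 ⊔ Submodule.span ℂ {g F, (a†) (a (g F))}, by
      have := F.2
      have := FiniteDimensional.span_of_finite ℂ (Set.toFinite {g F, (a†) (a (g F))})
      exact Submodule.finiteDimensional_sup _ _⟩
  let P : ℕ → {F : Submodule ℂ H // FiniteDimensional ℂ F} := fun n =>
    Nat.rec ⟨⊥, finiteDimensional_bot ℂ H⟩ (fun _ F => next F) n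
  have hP : ∀ n, P (n + 1) = next (P n) := fun _ => rfl
  have hmono : Monotone fun n => (P n).1 := monotone_nat_of_le_succ fun n => by
    rw [hP]; exact le_sup_left
  let e : ℕ → H := fun n => g (P n)
  have hmem : ∀ m n, m < n → e m ∈ (P n).1 ∧ (a†) (a (e m)) ∈ (P n).1 := by
    intro m n h
    have hle : (P (m + 1)).1 ≤ (P n).1 := hmono h
    have hsub : ∀ w ∈ ({g (P m), (a†) (a (g (P m)))} : Set H), w ∈ (P n).1 := fun w hw =>
      hle (Submodule.mem_sup_right (Submodule.subset_span hw))
    exact ⟨hsub _ (Or.inl rfl), hsub _ (Or.inr rfl)⟩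
  have horth : ∀ m n, m < n → ⟪e m, e n⟫_ℂ = 0 := fun m n h =>
    (Submodule.mem_orthogonal _ _).1 (hg (P n)).1 _ (hmem m n h).1
  have horth' : ∀ m n, m < n → ⟪a (e m), a (e n)⟫_ℂ = 0 := fun m n h => by
    have := (Submodule.mem_orthogonal _ _).1 (hg (P n)).1 _ (hmem m n h).2
    rwa [ContinuousLinearMap.adjoint_inner_left] at this
  have he : Orthonormal ℂ e := by
    refine ⟨fun n => (hg (P n)).2.1, fun m n hmn => ?_⟩
    rcases lt_or_gt_of_ne hmn with h | h
    · exact horth m n h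
    · exact inner_eq_zero_symm.1 (horth n m h)
  have hb : ∀ n, δ ≤ ‖a (e n)‖ := fun n => (hg (P n)).2.2
  have hb0 : ∀ n, ‖a (e n)‖ ≠ 0 := fun n => (hδ.trans_le (hb n)).ne'
  have hf : Orthonormal ℂ fun n => ((‖a (e n)‖⁻¹ : ℝ) : ℂ) • a (e n) := by
    refine ⟨fun n => ?_, fun m n hmn => ?_⟩
    · rw [norm_smul, Complex.norm_real, norm_inv, norm_norm, inv_mul_cancel₀ (hb0 n)]
    · have : ⟪a (e m), a (e n)⟫_ℂ = 0 := by
        rcases lt_or_gt_of_ne hmn with h | h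
        · exact horth' m n h
        · exact inner_eq_zero_symm.1 (horth' n m h)
      change ⟪_, _⟫_ℂ = 0
      rw [inner_smul_left, inner_smul_right, this, mul_zero, mul_zero]
  have hbd : BoundedSeq fun n => ‖a (e n)‖⁻¹ := ⟨δ⁻¹, fun n => by
    rw [abs_of_nonneg (inv_nonneg.2 (norm_nonneg _))]
    exact inv_anti₀ hδ (hb n)⟩
  -- `a` sends the orthonormal `e n` to orthogonal vectors of norm at least `δ`, so the inverse is
  -- diagonal and bounded by `δ⁻¹`.
  refine ⟨isometryOf he, diag (isometryOf hf) (isometryOf he) fun n => ‖a (e n)‖⁻¹, ?_⟩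
  refine clm_ext_unitVec fun n => ?_
  change isometryOf he (unitVec n) = diag (isometryOf hf) (isometryOf he) (fun n => ‖a (e n)‖⁻¹)
    (a (isometryOf he (unitVec n)))
  have hae : a (e n) = (‖a (e n)‖ : ℂ) • isometryOf hf (unitVec n) := by
    rw [isometryOf_unitVec, smul_smul, ← Complex.ofReal_mul, mul_inv_cancel₀ (hb0 n),
      Complex.ofReal_one, one_smul]
  conv_rhs => rw [isometryOf_unitVec he n, hae, map_smul, diag_unitVec _ _ hbd, smul_smul,
    ← Complex.ofReal_mul, mul_inv_cancel₀ (hb0 n), Complex.ofReal_one, one_smul]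

end NonCompact

/-! ### Sets of compact operators with a symmetric gauge -/

/-- The sequence that takes the value `η n` at `π n` and vanishes off the range of `π`. -/
def pushforward (π : ℕ → ℕ) (η : ℕ → ℝ) : ℕ → ℝ := Function.extend π η fun _ => 0

theorem pushforward_apply {π : ℕ → ℕ} (hπ : Function.Injective π) (η : ℕ → ℝ) (n : ℕ) :
    pushforward π η (π n) = η n := hπ.extend_apply η _ n

theorem pushforward_of_notMem {π : ℕ → ℕ} (η : ℕ → ℝ) {k : ℕ} (hk : k ∉ Set.range π) :
    pushforward π η k = 0 := Function.extend_apply' η _ k hk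

theorem pushforward_comp {π : ℕ → ℕ} (hπ : Function.Injective π) (η : ℕ → ℝ) :
    pushforward π η ∘ π = η := funext (pushforward_apply hπ η)

section Symmetric

variable {H : Type*} [NormedAddCommGroup H] [InnerProductSpace ℂ H] [CompleteSpace H]

/-- A set of compact operators stable under two-sided multiplication, with a function that does
not increase under multiplication by contractions. -/
structure IsSymmetricGauge (S : Set (H →L[ℂ] H)) (N : (H →L[ℂ] H) → ℝ) : Prop where
  mul_mem : ∀ x ∈ S, ∀ a b : H →L[ℂ] H, a * x * b ∈ S
  le : ∀ x ∈ S, ∀ a b : H →L[ℂ] H, ‖a‖ ≤ 1 → ‖b‖ ≤ 1 → N (a * x * b) ≤ N x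
  compact : ∀ x ∈ S, IsCompactOperator x

namespace IsSymmetricGauge

variable {S : Set (H →L[ℂ] H)} {N : (H →L[ℂ] H) → ℝ} (hS : IsSymmetricGauge S N)
include hS

theorem mem_and_le_of_isSchmidt {x y : H →L[ℂ] H} {s : ℕ → ℝ} (hx : IsSchmidt x s)
    (hy : IsSchmidt y s) (hxS : x ∈ S) : y ∈ S ∧ N y ≤ N x := by
  obtain ⟨V, -⟩ := hx.exists_diag
  obtain ⟨a, b, ha, hb, hab⟩ := hx.exists_diag_eq_mul_mul V V
  obtain ⟨c, d, hc, hd, hcd⟩ := hy.exists_eq_mul_diag_mul V V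
  have h1 : a * x * b ∈ S := hS.mul_mem x hxS a b
  rw [hcd, hab]
  exact ⟨hS.mul_mem _ h1 c d, (hS.le _ h1 c d hc hd).trans (hS.le x hxS a b ha hb)⟩

theorem eq_of_isSchmidt {x y : H →L[ℂ] H} {s : ℕ → ℝ} (hx : IsSchmidt x s)
    (hy : IsSchmidt y s) (hxS : x ∈ S) : N y = N x := by
  have h := hS.mem_and_le_of_isSchmidt hx hy hxS
  exact le_antisymm h.2 (hS.mem_and_le_of_isSchmidt hy hx h.1).2

variable (hH : ¬ FiniteDimensional ℂ H)
include hH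

/-- The freedom in `V` and `W` is essential later: sums and products need matching isometries,
rearrangements need reindexed ones. -/
theorem mem_seqSpace_iff (V W : Ell2 →ₗᵢ[ℂ] H) {ξ : ℕ → ℝ} :
    ξ ∈ seqSpace S ↔ Tendsto ξ atTop (𝓝 0) ∧ diag V W ξ ∈ S := by
  refine and_congr_right fun hξ => ⟨?_, fun h => ⟨_, h, (singularValue_diag V W hξ).symm⟩⟩
  rintro ⟨x, hx, heq⟩
  have h1 := isSchmidt_singularValue hH (hS.compact x hx)
  rw [← heq] at h1
  exact (hS.mem_and_le_of_isSchmidt h1 (isSchmidt_diag V W hξ) hx).1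

theorem seqNorm_eq {ξ : ℕ → ℝ} {x : H →L[ℂ] H} (hx : x ∈ S)
    (h : rearrangement ξ = singularValue x) : seqNorm S N ξ = N x := by
  have : {r : ℝ | ∃ x ∈ S, rearrangement ξ = singularValue x ∧ r = N x} = {N x} := by
    ext r
    constructor
    · rintro ⟨y, hy, hxy, rfl⟩
      have h1 := isSchmidt_singularValue hH (hS.compact x hx)
      have h2 := isSchmidt_singularValue hH (hS.compact y hy)
      rw [← h] at h1
      rw [← hxy] at h2
      exact hS.eq_of_isSchmidt h1 h2 hx
    · rintro rfl
      exact ⟨x, hx, h, rfl⟩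
  rw [seqNorm, this, csInf_singleton]

theorem seqNorm_eq_diag (V W : Ell2 →ₗᵢ[ℂ] H) {ξ : ℕ → ℝ} (hξ : ξ ∈ seqSpace S) :
    seqNorm S N ξ = N (diag V W ξ) :=
  hS.seqNorm_eq hH ((hS.mem_seqSpace_iff hH V W).1 hξ).2 (singularValue_diag V W hξ.1).symm

theorem singularValue_mem_iff {x : H →L[ℂ] H} (hx : IsCompactOperator x) :
    singularValue x ∈ seqSpace S ↔ x ∈ S := by
  have h1 := isSchmidt_singularValue hH hx
  have h2 := rearrangement_of_antitone h1.antitone h1.nonneg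
  refine ⟨fun h => ?_, fun h => ⟨h1.tendsto, x, h, h2⟩⟩
  obtain ⟨-, y, hy, hyx⟩ := h
  rw [h2] at hyx
  have h3 := isSchmidt_singularValue hH (hS.compact y hy)
  rw [← hyx] at h3
  exact (hS.mem_and_le_of_isSchmidt h3 h1 hy).1

theorem seqNorm_singularValue {x : H →L[ℂ] H} (hx : x ∈ S) :
    seqNorm S N (singularValue x) = N x := by
  have h1 := isSchmidt_singularValue hH (hS.compact x hx)
  exact hS.seqNorm_eq hH hx (rearrangement_of_antitone h1.antitone h1.nonneg)

theorem mem_seqSpace_of_le {ξ ζ : ℕ → ℝ} (hξ : ξ ∈ seqSpace S) {C : ℝ}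
    (h : ∀ n, |ζ n| ≤ C * |ξ n|) : ζ ∈ seqSpace S := by
  obtain ⟨V⟩ := exists_isometry hH
  rw [hS.mem_seqSpace_iff hH V V] at hξ ⊢
  have hz : Tendsto ζ atTop (𝓝 0) := squeeze_zero_norm (a := fun n => C * |ξ n|) h
    (by simpa using (hξ.1.abs.const_mul C))
  -- `ζ` is `ξ` times a bounded sequence. Where `ξ` vanishes so does `ζ`, and the quotient has the
  -- harmless value 0.
  have hC : ∀ n, |ζ n / ξ n| ≤ |C| := fun n => by
    rcases eq_or_ne (ξ n) 0 with h0 | h0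
    · simp [h0]
    · rw [abs_div, div_le_iff₀ (abs_pos.2 h0)]
      exact (h n).trans (mul_le_mul_of_nonneg_right (le_abs_self C) (abs_nonneg _))
  have heq : ζ = (fun n => ζ n / ξ n) * ξ := by
    funext n
    rcases eq_or_ne (ξ n) 0 with h0 | h0
    · have := h n
      rw [h0, abs_zero, mul_zero] at this
      simp [h0, abs_nonpos_iff.1 this]
    · simp [h0]
  refine ⟨hz, ?_⟩
  rw [heq, ← diag_mul_diag V V V ⟨|C|, hC⟩ (BoundedSeq.of_tendsto hξ.1)]
  simpa using hS.mul_mem _ hξ.2 (diag V V fun n => ζ n / ξ n) 1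

theorem seqNorm_le_of_le {ξ ζ : ℕ → ℝ} (hξ : ξ ∈ seqSpace S)
    (h : ∀ n, |ζ n| ≤ |ξ n|) : seqNorm S N ζ ≤ seqNorm S N ξ := by
  obtain ⟨V⟩ := exists_isometry hH
  have hζ : ζ ∈ seqSpace S := hS.mem_seqSpace_of_le hH (C := 1) hξ fun n => by
    simpa using h n
  rw [hS.seqNorm_eq_diag hH V V hξ, hS.seqNorm_eq_diag hH V V hζ]
  have hC : ∀ n, |ζ n / ξ n| ≤ 1 := fun n => by
    rw [abs_div]
    exact div_le_one_of_le₀ (h n) (abs_nonneg _)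
  have heq : ζ = (fun n => ζ n / ξ n) * ξ := by
    funext n
    rcases eq_or_ne (ξ n) 0 with h0 | h0
    · have := h n
      rw [h0, abs_zero] at this
      simp [h0, abs_nonpos_iff.1 this]
    · simp [h0]
  have h1 := hS.le _ ((hS.mem_seqSpace_iff hH V V).1 hξ).2 (diag V V fun n => ζ n / ξ n) 1
    (norm_diag_le V V hC) ContinuousLinearMap.norm_id_le
  rwa [mul_one, diag_mul_diag V V V ⟨1, hC⟩ (BoundedSeq.of_tendsto hξ.1), ← heq] at h1

/-- Replacing `ξ` by zero off the range of `π` does not increase the gauge, and the truncated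
sequence has the same diagonal operator as `ξ ∘ π` along reindexed isometries. -/
theorem comp_mem_seqSpace {ξ : ℕ → ℝ} (hξ : ξ ∈ seqSpace S) {π : ℕ → ℕ}
    (hπ : Function.Injective π) :
    ξ ∘ π ∈ seqSpace S ∧ seqNorm S N (ξ ∘ π) ≤ seqNorm S N ξ := by
  classical
  obtain ⟨V⟩ := exists_isometry hH
  let ζ : ℕ → ℝ := (Set.range π).indicator ξ
  have hle : ∀ n, |ζ n| ≤ |ξ n| := fun n => by
    by_cases hn : n ∈ Set.range π
    · rw [show ζ n = ξ n from Set.indicator_of_mem hn ξ]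
    · rw [show ζ n = 0 from Set.indicator_of_notMem hn ξ, abs_zero]
      exact abs_nonneg _
  have hζ : ζ ∈ seqSpace S := hS.mem_seqSpace_of_le hH (C := 1) hξ fun n => by simpa using hle n
  have hcomp : ζ ∘ π = ξ ∘ π := funext fun n =>
    Set.indicator_of_mem (Set.mem_range_self n) ξ
  have hd : diag (V.comp (reindex hπ)) (V.comp (reindex hπ)) (ξ ∘ π) = diag V V ζ := by
    rw [← hcomp]
    exact diag_comp_reindex V V (BoundedSeq.of_tendsto hζ.1) hπ fun k hk =>
      Set.indicator_of_notMem hk ξ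
  have hmem : ξ ∘ π ∈ seqSpace S := by
    rw [hS.mem_seqSpace_iff hH (V.comp (reindex hπ)) (V.comp (reindex hπ)), hd]
    exact ⟨hξ.1.comp hπ.nat_tendsto_atTop, ((hS.mem_seqSpace_iff hH V V).1 hζ).2⟩
  refine ⟨hmem, ?_⟩
  rw [hS.seqNorm_eq_diag hH (V.comp (reindex hπ)) (V.comp (reindex hπ)) hmem, hd,
    ← hS.seqNorm_eq_diag hH V V hζ]
  exact hS.seqNorm_le_of_le hH hξ hle

/-- Equality holds because inserting zeros leaves the diagonal operator literally unchanged once the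
isometries are reindexed. -/
theorem pushforward_mem_seqSpace {η : ℕ → ℝ} (hη : η ∈ seqSpace S) {π : ℕ → ℕ}
    (hπ : Function.Injective π) :
    pushforward π η ∈ seqSpace S ∧
      seqNorm S N (pushforward π η) = seqNorm S N η := by
  obtain ⟨V⟩ := exists_isometry hH
  have htend : Tendsto (pushforward π η) atTop (𝓝 0) := by
    rw [← Nat.cofinite_eq_atTop, Metric.tendsto_nhds]
    intro ε hε
    have hf : {n | ¬ dist (η n) 0 < ε}.Finite := by
      have := hη.1
      rw [← Nat.cofinite_eq_atTop, Metric.tendsto_nhds] at this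
      exact this ε hε
    refine (hf.image π).subset fun k hk => ?_
    by_cases hr : k ∈ Set.range π
    · obtain ⟨n, rfl⟩ := hr
      refine ⟨n, ?_, rfl⟩
      have hk' : ¬ dist (pushforward π η (π n)) 0 < ε := hk
      rwa [pushforward_apply hπ] at hk'
    · have hk' : ¬ dist (pushforward π η k) 0 < ε := hk
      rw [pushforward_of_notMem η hr] at hk'
      exact absurd (by simpa using hε) hk'
  have hd : diag (V.comp (reindex hπ)) (V.comp (reindex hπ)) η =
      diag V V (pushforward π η) := by
    rw [← diag_comp_reindex V V (BoundedSeq.of_tendsto htend) hπ fun k hk =>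
      pushforward_of_notMem η hk, pushforward_comp hπ]
  have hmem : pushforward π η ∈ seqSpace S := by
    rw [hS.mem_seqSpace_iff hH V V, ← hd]
    exact ⟨htend, ((hS.mem_seqSpace_iff hH _ _).1 hη).2⟩
  exact ⟨hmem, by rw [hS.seqNorm_eq_diag hH V V hmem, ← hd, ← hS.seqNorm_eq_diag hH _ _ hη]⟩

end IsSymmetricGauge

end Symmetric

variable {H : Type*} [NormedAddCommGroup H] [InnerProductSpace ℂ H] [CompleteSpace H]

theorem le_concavityModulus_mul {X : Type*} [Add X] {S : Set X} {N : X → ℝ}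
    (h0 : ∀ x ∈ S, 0 ≤ N x)
    (hex : ∃ C : ℝ, 1 ≤ C ∧ ∀ x ∈ S, ∀ y ∈ S, N (x + y) ≤ C * (N x + N y))
    {x y : X} (hx : x ∈ S) (hy : y ∈ S) : N (x + y) ≤ concavityModulus S N * (N x + N y) := by
  obtain ⟨C, hC1, hC⟩ := hex
  -- The bound survives the infimum after division by `N x + N y`; when that sum is zero, any
  -- admissible constant settles it.
  rcases (add_nonneg (h0 x hx) (h0 y hy)).eq_or_lt with h | h
  · have := hC x hx y hy
    rwa [← h, mul_zero] at this ⊢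
  · rw [← div_le_iff₀ h]
    exact le_csInf ⟨C, hC1, hC⟩ fun D hD => (div_le_iff₀ h).2 (hD.2 x hx y hy)

theorem concavityModulus_nonneg {X : Type*} [Add X] (S : Set X) (N : X → ℝ) :
    0 ≤ concavityModulus S N :=
  Real.sInf_nonneg fun _ hC => zero_le_one.trans hC.1

/-! ### Completeness and boundedness of multipliers -/

namespace SymmetricQuasiBanachIdeal

theorem mul_mul_mem (I : SymmetricQuasiBanachIdeal H) {x : H →L[ℂ] H} (hx : x ∈ I.ideal)
    (a b : H →L[ℂ] H) : a * x * b ∈ I.ideal :=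
  I.ideal.mul_mem_right _ _ (I.ideal.mul_mem_left _ _ hx)

theorem qnorm_mul_mul_le (I : SymmetricQuasiBanachIdeal H) {x : H →L[ℂ] H} (hx : x ∈ I.ideal)
    {a b : H →L[ℂ] H} (ha : ‖a‖ ≤ 1) (hb : ‖b‖ ≤ 1) : I.qnorm (a * x * b) ≤ I.qnorm x := by
  have h0 := I.nonneg x hx
  calc I.qnorm (a * x * b) ≤ ‖a‖ * I.qnorm x * ‖b‖ := I.symm_le x hx a b
    _ ≤ 1 * I.qnorm x * 1 := by gcongr
    _ = I.qnorm x := by ring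

theorem isSymmetricGauge (I : SymmetricQuasiBanachIdeal H) : IsSymmetricGauge I.ops I.qnorm where
  mul_mem _ hx a b := I.mul_mul_mem hx a b
  le _ hx _ _ ha hb := I.qnorm_mul_mul_le hx ha hb
  compact := I.compact

theorem smul_mem (I : SymmetricQuasiBanachIdeal H) (c : ℂ) {x : H →L[ℂ] H} (hx : x ∈ I.ideal) :
    c • x ∈ I.ideal := by
  have := I.ideal.mul_mem_left (c • (1 : H →L[ℂ] H)) x hx
  rwa [smul_mul_assoc, one_mul] at this

theorem qnorm_zero (I : SymmetricQuasiBanachIdeal H) : I.qnorm 0 = 0 :=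
  (I.eq_zero_iff 0 I.ideal.zero_mem).2 rfl

theorem qnorm_sub_comm (I : SymmetricQuasiBanachIdeal H) {x y : H →L[ℂ] H} (hx : x ∈ I.ideal)
    (hy : y ∈ I.ideal) : I.qnorm (x - y) = I.qnorm (y - x) := by
  have h := I.smul (-1) (y - x) (I.ideal.sub_mem hy hx)
  rwa [norm_neg, norm_one, one_mul, neg_one_smul, neg_sub] at h

/-- Splitting off the first term leaves a tail of the same kind with `ρ / (2C)` for `ρ`, bounded by
`ρ` inductively; then `C * (ρ + ρ) = 2Cρ`. The ratio `1 / (2C)` is chosen to close this recursion.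
-/
theorem qnorm_sum_le (I : SymmetricQuasiBanachIdeal H) {C : ℝ} (hC1 : 1 ≤ C)
    (hC : ∀ x ∈ I.ideal, ∀ y ∈ I.ideal, I.qnorm (x + y) ≤ C * (I.qnorm x + I.qnorm y)) (k : ℕ) :
    ∀ (y : ℕ → H →L[ℂ] H) (ρ : ℝ), 0 ≤ ρ → (∀ i, y i ∈ I.ideal) →
      (∀ i, I.qnorm (y i) ≤ ρ * ((2 * C)⁻¹) ^ i) →
        I.qnorm (∑ i ∈ Finset.range k, y i) ≤ 2 * C * ρ := by
  have hC0 : 0 < C := by linarith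
  induction k with
  | zero =>
    intro y ρ hρ _ _
    rw [Finset.sum_range_zero, I.qnorm_zero]
    positivity
  | succ k ih =>
    intro y ρ hρ hy hle
    rw [Finset.sum_range_succ']
    have h1 := ih (fun i => y (i + 1)) (ρ * (2 * C)⁻¹) (by positivity) (fun i => hy _)
      fun i => (hle (i + 1)).trans (by rw [pow_succ']; exact (mul_assoc _ _ _).ge)
    have h2 := hle 0
    rw [pow_zero, mul_one] at h2
    have h3 : 2 * C * (ρ * (2 * C)⁻¹) = ρ := by field_simp
    rw [h3] at h1
    refine (hC _ (sum_mem fun i _ => hy _) _ (hy 0)).trans ?_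
    nlinarith

/-- Absolutely convergent series, in the sense of a geometric bound, converge. -/
theorem exists_tendsto_sum (I : SymmetricQuasiBanachIdeal H) {C : ℝ} (hC1 : 1 ≤ C)
    (hC : ∀ x ∈ I.ideal, ∀ y ∈ I.ideal, I.qnorm (x + y) ≤ C * (I.qnorm x + I.qnorm y))
    {y : ℕ → H →L[ℂ] H} (hy : ∀ i, y i ∈ I.ideal)
    (hle : ∀ i, I.qnorm (y i) ≤ ((2 * C)⁻¹) ^ i) :
    ∃ x ∈ I.ideal,
      Tendsto (fun n => I.qnorm ((∑ i ∈ Finset.range n, y i) - x)) atTop (𝓝 0) := by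
  have hC0 : 0 < C := by linarith
  have hr : (2 * C)⁻¹ < 1 := inv_lt_one_of_one_lt₀ (by linarith)
  have hmem : ∀ n, ∑ i ∈ Finset.range n, y i ∈ I.ideal := fun n => sum_mem fun i _ => hy i
  have hdiff : ∀ m n, m ≤ n → I.qnorm ((∑ i ∈ Finset.range n, y i) - ∑ i ∈ Finset.range m, y i) ≤
      2 * C * ((2 * C)⁻¹) ^ m := by
    intro m n hmn
    obtain ⟨k, rfl⟩ := Nat.exists_eq_add_of_le hmn
    rw [Finset.sum_range_add, add_sub_cancel_left]
    exact I.qnorm_sum_le hC1 hC k (fun i => y (m + i)) _ (by positivity) (fun i => hy _)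
      fun i => (hle _).trans (pow_add _ _ _).le
  refine I.complete _ hmem fun ε hε => ?_
  have htend : Tendsto (fun m => 2 * C * ((2 * C)⁻¹) ^ m) atTop (𝓝 0) := by
    simpa using (tendsto_pow_atTop_nhds_zero_of_lt_one (by positivity) hr).const_mul (2 * C)
  obtain ⟨N, hN⟩ := ((tendsto_order.1 htend).2 ε hε).exists_forall_of_atTop
  refine ⟨N, fun m hm n hn => ?_⟩
  rcases le_total m n with h | h
  · rw [I.qnorm_sub_comm (hmem m) (hmem n)]
    exact (hdiff m n h).trans_lt (hN m hm)
  · exact (hdiff n m h).trans_lt (hN n hn)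

theorem mul_mul_mem_dual (J I : SymmetricQuasiBanachIdeal H) {x : H →L[ℂ] H} (hx : x ∈ J.dual I)
    (a b : H →L[ℂ] H) : a * x * b ∈ J.dual I := by
  intro y hy
  have h := J.ideal.mul_mem_left a _ (hx (b * y) (I.ideal.mul_mem_left b y hy))
  rwa [← mul_assoc, ← mul_assoc] at h

theorem multiplierValues_nonempty (N : (H →L[ℂ] H) → ℝ) (I : SymmetricQuasiBanachIdeal H)
    (a : H →L[ℂ] H) : (multiplierValues N I.ops I.qnorm a).Nonempty :=
  ⟨_, 0, I.ideal.zero_mem, by rw [I.qnorm_zero]; exact zero_le_one, rfl⟩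

theorem adjoint_reindex_unitVec_eq_zero {π : ℕ → ℕ} (hπ : Function.Injective π) {k : ℕ}
    (hk : k ∉ Set.range π) : ((reindex hπ).toContinuousLinearMap†) (unitVec k) = 0 := by
  ext n
  rw [adjoint_reindex_apply, unitVec_apply, if_neg fun h => hk ⟨n, h⟩]
  rfl

theorem diag_mul_diag_of_disjoint (V : Ell2 →ₗᵢ[ℂ] H) (ξ η : ℕ → ℝ) {π ρ : ℕ → ℕ}
    (hπ : Function.Injective π) (hρ : Function.Injective ρ)
    (hd : ∀ n, π n ∉ Set.range ρ) :
    diag (V.comp (reindex hπ)) V ξ * diag V (V.comp (reindex hρ)) η = 0 := by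
  ext v
  rw [mul_apply_eq_comp, diag_apply, diag_apply]
  set f := mulSeq η ((V.toContinuousLinearMap†) v)
  have h : ((V.comp (reindex hπ)).toContinuousLinearMap†) ((V.comp (reindex hρ)) f) = 0 := by
    ext n
    rw [adjoint_apply_coord]
    have hu : reindex hπ (unitVec n) = unitVec (π n) := isometryOf_unitVec _ n
    refine (V.inner_map_map (reindex hπ (unitVec n)) (reindex hρ f)).trans ?_
    rw [hu]
    refine (ContinuousLinearMap.adjoint_inner_left (reindex hρ).toContinuousLinearMap f
      (unitVec (π n))).symm.trans ?_
    rw [adjoint_reindex_unitVec_eq_zero hρ (hd n)]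
    exact inner_zero_left _
  rw [h, map_zero, map_zero]
  rfl

variable (hH : ¬ FiniteDimensional ℂ H)
include hH

/-- Given a sequence in the unit ball, some element of the ideal is carried by contractions onto
geometrically small multiples of all of its terms. -/
theorem exists_mul_eq_smul (I : SymmetricQuasiBanachIdeal H) :
    ∃ r : ℝ, 0 < r ∧ ∀ x : ℕ → H →L[ℂ] H, (∀ n, x n ∈ I.ideal) → (∀ n, I.qnorm (x n) ≤ 1) →
      ∃ z ∈ I.ideal, ∀ n, ∃ b : H →L[ℂ] H, ‖b‖ ≤ 1 ∧ z * b = ((r ^ n : ℝ) : ℂ) • x n := by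
  obtain ⟨C, hC1, hC⟩ := I.add_le
  have hC0 : 0 < C := by linarith
  refine ⟨(2 * C)⁻¹, by positivity, fun x hx hx1 => ?_⟩
  set r := (2 * C)⁻¹ with hr
  have hr0 : 0 ≤ r := by positivity
  obtain ⟨V⟩ := exists_isometry hH
  have hs := fun n => isSchmidt_singularValue hH (I.compact _ (hx n))
  choose a b ha hb hab using fun n => (hs n).exists_eq_mul_diag_mul V V
  choose c d hc hd hcd using fun n => (hs n).exists_diag_eq_mul_mul V V
  -- `Nat.pair` splits ℕ into infinitely many disjoint infinite blocks, one for each `x n`.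
  have hinj : ∀ n, Function.Injective (Nat.pair n) := fun n i j h => (Nat.pair_eq_pair.1 h).2
  have hdisj : ∀ m n, m ≠ n → ∀ i, Nat.pair m i ∉ Set.range (Nat.pair n) := by
    rintro m n hmn i ⟨j, hj⟩
    exact hmn (Nat.pair_eq_pair.1 hj).1.symm
  let W : ℕ → Ell2 →ₗᵢ[ℂ] H := fun n => V.comp (reindex (hinj n))
  -- `w n` is `x n` with its source moved to block `n`. Right multiplication by a contraction `R`
  -- recovers `x n` from it and kills the other `w m`.
  let w : ℕ → H →L[ℂ] H := fun n => a n * diag (W n) V (singularValue (x n))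
  have hw : ∀ n, w n ∈ I.ideal ∧ I.qnorm (w n) ≤ 1 := by
    intro n
    have h1 : w n = a n * c n * x n * (d n * diag (W n) V 1) := by
      simp only [w]
      rw [← diag_mul_one (W n) V V (hs n).boundedSeq, hcd]
      simp only [mul_assoc]
    rw [h1]
    refine ⟨I.mul_mul_mem (hx n) _ _, (I.qnorm_mul_mul_le (hx n) ?_ ?_).trans (hx1 n)⟩
    · exact (norm_mul_le _ _).trans (mul_le_one₀ (ha n) (norm_nonneg _) (hc n))
    · exact (norm_mul_le _ _).trans (mul_le_one₀ (hd n) (norm_nonneg _) (norm_diag_one_le _ _))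
  let y : ℕ → H →L[ℂ] H := fun n => ((r ^ n : ℝ) : ℂ) • w n
  have hy : ∀ n, y n ∈ I.ideal := fun n => I.smul_mem _ (hw n).1
  have hyle : ∀ n, I.qnorm (y n) ≤ r ^ n := fun n => by
    rw [I.smul _ _ (hw n).1, Complex.norm_real, Real.norm_eq_abs, abs_of_nonneg (pow_nonneg hr0 n)]
    exact mul_le_of_le_one_right (pow_nonneg hr0 n) (hw n).2
  obtain ⟨z, hz, htend⟩ := I.exists_tendsto_sum hC1 hC hy hyle
  refine ⟨z, hz, fun n => ⟨diag V (W n) 1 * b n, ?_, ?_⟩⟩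
  · exact (norm_mul_le _ _).trans (mul_le_one₀ (norm_diag_one_le _ _) (norm_nonneg _) (hb n))
  set R := diag V (W n) 1 * b n with hR
  have hRn : ‖R‖ ≤ 1 :=
    (norm_mul_le _ _).trans (mul_le_one₀ (norm_diag_one_le _ _) (norm_nonneg _) (hb n))
  have hyR : ∀ m, y m * R = if m = n then ((r ^ n : ℝ) : ℂ) • x n else 0 := by
    intro m
    split_ifs with h
    · subst h
      have h1 : w m * R = x m := by
        simp only [w, hR]
        rw [mul_assoc, ← mul_assoc (diag _ _ _), diag_mul_one _ _ _ (hs m).boundedSeq,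
          ← mul_assoc, ← hab]
      rw [smul_mul_assoc, h1]
    · have h1 : w m * R = 0 := by
        simp only [w, hR]
        rw [mul_assoc, ← mul_assoc (diag _ _ _),
          diag_mul_diag_of_disjoint V _ _ (hinj m) (hinj n) (hdisj m n h), zero_mul, mul_zero]
      rw [smul_mul_assoc, h1, smul_zero]
  have hsum : ∀ N, n < N → (∑ i ∈ Finset.range N, y i) * R = ((r ^ n : ℝ) : ℂ) • x n := by
    intro N hN
    rw [Finset.sum_mul, Finset.sum_congr rfl fun m _ => hyR m, Finset.sum_ite_eq',
      if_pos (Finset.mem_range.2 hN)]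
  have hmem : ((r ^ n : ℝ) : ℂ) • x n - z * R ∈ I.ideal :=
    I.ideal.sub_mem (I.smul_mem _ (hx n)) (I.ideal.mul_mem_right _ _ hz)
  -- Partial sums times `R` are eventually constant, so the limit is identified by this estimate
  -- alone, without continuity of the quasi-norm.
  have hle : ∀ᶠ N in atTop, I.qnorm (((r ^ n : ℝ) : ℂ) • x n - z * R) ≤
      I.qnorm ((∑ i ∈ Finset.range N, y i) - z) := by
    filter_upwards [eventually_gt_atTop n] with N hN
    rw [← hsum N hN, ← sub_mul]
    have hSz : (∑ i ∈ Finset.range N, y i) - z ∈ I.ideal :=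
      I.ideal.sub_mem (sum_mem fun i _ => hy i) hz
    have := I.qnorm_mul_mul_le hSz (a := 1) (b := R) ContinuousLinearMap.norm_id_le hRn
    rwa [one_mul] at this
  have h0 : I.qnorm (((r ^ n : ℝ) : ℂ) • x n - z * R) = 0 :=
    le_antisymm (ge_of_tendsto htend hle) (I.nonneg _ hmem)
  exact (sub_eq_zero.1 ((I.eq_zero_iff _ hmem).1 h0)).symm

/-- Gliding hump: with `J.qnorm (a * x n) > n / r ^ n` and `z` packing all `x n`, the value `J.qnorm
(a * z)` would be at least `r ^ n * J.qnorm (a * x n) > n` for every `n`. -/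
theorem bddAbove_multiplierValues (I J : SymmetricQuasiBanachIdeal H) {a : H →L[ℂ] H}
    (ha : a ∈ J.dual I) : BddAbove (multiplierValues J.qnorm I.ops I.qnorm a) := by
  obtain ⟨r, hr, hex⟩ := exists_mul_eq_smul hH I
  by_contra hb
  rw [not_bddAbove_iff] at hb
  have hx : ∀ n : ℕ, ∃ x ∈ I.ideal, I.qnorm x ≤ 1 ∧ n / r ^ n < J.qnorm (a * x) := by
    intro n
    obtain ⟨_, ⟨x, hx, hx1, rfl⟩, hlt⟩ := hb (n / r ^ n)
    exact ⟨x, hx, hx1, hlt⟩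
  choose x hx hx1 hlt using hx
  obtain ⟨z, hz, hzb⟩ := hex x hx hx1
  obtain ⟨n, hn⟩ := exists_nat_gt (J.qnorm (a * z))
  obtain ⟨b, hb1, hb⟩ := hzb n
  have h1 := J.qnorm_mul_mul_le (ha z hz) (a := 1) (b := b) ContinuousLinearMap.norm_id_le hb1
  rw [one_mul, mul_assoc, hb, mul_smul_comm, J.smul _ _ (ha _ (hx n)), Complex.norm_real,
    Real.norm_eq_abs, abs_of_pos (pow_pos hr n)] at h1
  have h2 := (div_lt_iff₀' (pow_pos hr n)).1 (hlt n)
  linarith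

/-! ### Comparison of the operator dual with the sequence dual -/

variable (J I : SymmetricQuasiBanachIdeal H)

/-- If `a` had a left inverse `u` on the range of `V`, then `diag V V s(x) = u * (a * diag V V
s(x))` would lie in `J` for each `x` in `I`, hence so would `x`. -/
theorem isCompactOperator_of_mem_dual (hIJ : ¬ I.ops ⊆ J.ops) {a : H →L[ℂ] H}
    (ha : a ∈ J.dual I) : IsCompactOperator a := by
  by_contra hnc
  obtain ⟨V, u, hu⟩ := exists_left_inverse_on_of_not_compact hnc
  refine hIJ fun x hx => ?_
  have hs := isSchmidt_singularValue hH (I.compact x hx)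
  have h1 := (I.isSymmetricGauge.mem_and_le_of_isSchmidt hs
    (by simpa only [rearrangement_of_antitone hs.antitone hs.nonneg]
      using isSchmidt_diag V V hs.tendsto) hx).1
  have h2 : diag V V (singularValue x) = u * (a * diag V V (singularValue x)) := by
    ext v
    exact congrArg (fun T : Ell2 →L[ℂ] H => T (mulSeq (singularValue x)
      ((V.toContinuousLinearMap†) v))) hu
  have h3 : diag V V (singularValue x) ∈ J.ops := by
    rw [h2]
    exact J.ideal.mul_mem_left _ _ (ha _ h1)
  exact (J.isSymmetricGauge.mem_and_le_of_isSchmidt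
    (by simpa only [rearrangement_of_antitone hs.antitone hs.nonneg]
      using isSchmidt_diag V V hs.tendsto) hs h3).1

theorem isSymmetricGauge_dual (hIJ : ¬ I.ops ⊆ J.ops) :
    IsSymmetricGauge (J.dual I) (J.normDual I) where
  mul_mem _ hx a b := J.mul_mul_mem_dual I hx a b
  compact _ hx := isCompactOperator_of_mem_dual hH J I hIJ hx
  le x hx a b ha hb := by
    refine csSup_le (multiplierValues_nonempty _ I _) ?_
    rintro _ ⟨y, hy, hy1, rfl⟩
    have hby : b * y ∈ I.ideal := I.ideal.mul_mem_left b y hy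
    have h1 := I.qnorm_mul_mul_le hy hb (b := 1) ContinuousLinearMap.norm_id_le
    rw [mul_one] at h1
    have h2 := J.qnorm_mul_mul_le (hx (b * y) hby) ha (b := 1) ContinuousLinearMap.norm_id_le
    rw [mul_one] at h2
    rw [mul_assoc, mul_assoc]
    exact h2.trans (le_csSup (bddAbove_multiplierValues hH I J hx) ⟨_, hby, h1.trans hy1, rfl⟩)

theorem add_mem_E {ξ η : ℕ → ℝ} (hξ : ξ ∈ J.E) (hη : η ∈ J.E) : ξ + η ∈ J.E := by
  obtain ⟨V⟩ := exists_isometry hH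
  have hJ := J.isSymmetricGauge
  refine (hJ.mem_seqSpace_iff hH V V).2 ⟨?_, ?_⟩
  · have h := hξ.1.add hη.1
    rwa [add_zero] at h
  rw [diag_add V V (BoundedSeq.of_tendsto hξ.1) (BoundedSeq.of_tendsto hη.1)]
  exact J.ideal.add_mem ((hJ.mem_seqSpace_iff hH V V).1 hξ).2 ((hJ.mem_seqSpace_iff hH V V).1 hη).2

theorem normE_add_le {C : ℝ}
    (hC : ∀ x ∈ J.ops, ∀ y ∈ J.ops, J.qnorm (x + y) ≤ C * (J.qnorm x + J.qnorm y))
    {ξ η : ℕ → ℝ} (hξ : ξ ∈ J.E) (hη : η ∈ J.E) :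
    J.normE (ξ + η) ≤ C * (J.normE ξ + J.normE η) := by
  obtain ⟨V⟩ := exists_isometry hH
  have hJ := J.isSymmetricGauge
  have h1 := hC _ ((hJ.mem_seqSpace_iff hH V V).1 hξ).2 _ ((hJ.mem_seqSpace_iff hH V V).1 hη).2
  rwa [← diag_add V V (BoundedSeq.of_tendsto hξ.1) (BoundedSeq.of_tendsto hη.1),
    ← hJ.seqNorm_eq_diag hH V V hξ, ← hJ.seqNorm_eq_diag hH V V hη,
    ← hJ.seqNorm_eq_diag hH V V (add_mem_E hH J hξ hη)] at h1

theorem normE_nonneg {ξ : ℕ → ℝ} (hξ : ξ ∈ J.E) : 0 ≤ J.normE ξ := by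
  obtain ⟨V⟩ := exists_isometry hH
  have hJ := J.isSymmetricGauge
  have h1 := J.nonneg _ ((hJ.mem_seqSpace_iff hH V V).1 hξ).2
  rwa [← hJ.seqNorm_eq_diag hH V V hξ] at h1

/-- The commutative counterpart: if `|ξ| ≥ ε` on an infinite set, moving `s(x)` onto that set,
multiplying by `ξ` and dividing again shows `s(x) ∈ E_J`. -/
theorem tendsto_of_mem_dualE (hIJ : ¬ I.ops ⊆ J.ops) {ξ : ℕ → ℝ} (hξ : ξ ∈ J.dualE I) :
    Tendsto ξ atTop (𝓝 0) := by
  by_contra hnt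
  have hex : ∃ ε > 0, {n | ε ≤ |ξ n|}.Infinite := by
    rw [← Nat.cofinite_eq_atTop, Metric.tendsto_nhds] at hnt
    push Not at hnt
    obtain ⟨ε, hε, hf⟩ := hnt
    refine ⟨ε, hε, fun hfin => hf ?_⟩
    refine hfin.subset fun n hn => ?_
    simpa [Real.dist_eq] using hn
  obtain ⟨ε, hε, hinf⟩ := hex
  have := hinf.to_subtype
  let f := Infinite.natEmbedding {n | ε ≤ |ξ n|}
  let π : ℕ → ℕ := fun n => f n
  have hπ : Function.Injective π := Subtype.val_injective.comp f.injective
  have hle : ∀ n, ε ≤ |ξ (π n)| := fun n => (f n).2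
  have hI := I.isSymmetricGauge
  have hJ := J.isSymmetricGauge
  refine hIJ fun x hx => ?_
  have hs := isSchmidt_singularValue hH (I.compact x hx)
  have h1 := (hI.singularValue_mem_iff hH (I.compact x hx)).2 hx
  have h2 := hξ.2 _ (hI.pushforward_mem_seqSpace hH h1 hπ).1
  have h3 := (hJ.comp_mem_seqSpace hH h2 hπ).1
  have h4 : singularValue x ∈ seqSpace J.ops := by
    refine hJ.mem_seqSpace_of_le hH (C := ε⁻¹) h3 fun n => ?_
    rw [Function.comp, Pi.mul_apply, pushforward_apply hπ, abs_mul, ← mul_assoc]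
    refine le_mul_of_one_le_left (abs_nonneg _) ?_
    rw [inv_mul_eq_div, one_le_div hε]
    exact hle n
  exact (hJ.singularValue_mem_iff hH (I.compact x hx)).1 h4

/-- In absolute value, `rearrangement ξ * η` is `ξ * pushforward π η` read along `π`. This is needed
because the singular values of `diag V V ξ` are the rearrangement of `ξ`, not `ξ`. -/
theorem exists_rearrangement_mul_le {ξ : ℕ → ℝ} (hξ : ξ ∈ J.dualE I)
    (hnull : Tendsto ξ atTop (𝓝 0)) {η : ℕ → ℝ} (hη : η ∈ I.E) :
    rearrangement ξ * η ∈ J.E ∧ ∃ ζ ∈ I.E, I.normE ζ = I.normE η ∧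
      J.normE (rearrangement ξ * η) ≤ J.normE (ξ * ζ) := by
  obtain ⟨π, hπ, heq, -⟩ := exists_injective_rearrangement hnull
  have hI := I.isSymmetricGauge
  have hJ := J.isSymmetricGauge
  obtain ⟨h1, h2⟩ := hI.pushforward_mem_seqSpace hH hη hπ
  obtain ⟨h3, h4⟩ := hJ.comp_mem_seqSpace hH (hξ.2 _ h1) hπ
  have habs : ∀ n, |(rearrangement ξ * η) n| = |((ξ * pushforward π η) ∘ π) n| := fun n => by
    rw [heq, Function.comp, Pi.mul_apply, Pi.mul_apply, pushforward_apply hπ, abs_mul, abs_mul,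
      abs_abs]
  refine ⟨hJ.mem_seqSpace_of_le hH (C := 1) h3 fun n => by rw [one_mul, habs n], _, h1, h2, ?_⟩
  exact (hJ.seqNorm_le_of_le hH h3 fun n => (habs n).le).trans h4

/-- The product of `a` and `x` is estimated by twice repeating each term of the termwise product
of the sequences of singular values. -/
theorem mul_mem_and_qnorm_le {C : ℝ}
    (hC : ∀ ξ ∈ J.E, ∀ η ∈ J.E, J.normE (ξ + η) ≤ C * (J.normE ξ + J.normE η))
    {a x : H →L[ℂ] H} {s t : ℕ → ℝ} (ha : IsSchmidt a s) (hx : IsSchmidt x t)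
    (hax : IsCompactOperator (a * x : H →L[ℂ] H)) (hst : s * t ∈ J.E) :
    a * x ∈ J.ideal ∧ J.qnorm (a * x) ≤ 2 * C * J.normE (s * t) := by
  have hJ := J.isSymmetricGauge
  have hr := isSchmidt_singularValue hH hax
  have h2 : Function.Injective fun n : ℕ => 2 * n := fun i j h => by
    simp only at h; omega
  have h2' : Function.Injective fun n : ℕ => 2 * n + 1 := fun i j h => by
    simp only at h; omega
  obtain ⟨he, hen⟩ := hJ.pushforward_mem_seqSpace hH hst h2
  obtain ⟨ho, hon⟩ := hJ.pushforward_mem_seqSpace hH hst h2'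
  set ζ := pushforward (fun n : ℕ => 2 * n) (s * t) with hζ
  set ζ' := pushforward (fun n : ℕ => 2 * n + 1) (s * t) with hζ'
  -- `ζ + ζ'` lists each term of `s * t` twice; the indices `2n` and `2n + 1` are both controlled by
  -- the `2n`-th singular value.
  have hle : ∀ k, |singularValue (a * x) k| ≤ |(ζ + ζ') k| := by
    intro k
    rw [abs_of_nonneg (hr.nonneg k)]
    refine le_trans ?_ (le_abs_self _)
    rw [Pi.add_apply]
    obtain ⟨n, rfl | rfl⟩ := k.even_or_odd'
    · rw [hζ, hζ', pushforward_apply h2 (s * t) n, pushforward_of_notMem, add_zero]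
      · exact hr.mul_le ha hx n
      · rintro ⟨m, hm⟩
        simp only at hm
        omega
    · rw [hζ, hζ', pushforward_apply h2' (s * t) n, pushforward_of_notMem, zero_add]
      · exact (hr.antitone (Nat.le_succ _)).trans (hr.mul_le ha hx n)
      · rintro ⟨m, hm⟩
        simp only at hm
        omega
  have hsum := add_mem_E hH J he ho
  have hmem : singularValue (a * x) ∈ seqSpace J.ops :=
    hJ.mem_seqSpace_of_le hH (C := 1) hsum fun k => by simpa using hle k
  have haxJ := (hJ.singularValue_mem_iff hH hax).1 hmem
  refine ⟨haxJ, ?_⟩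
  calc J.qnorm (a * x) = J.normE (singularValue (a * x)) := (hJ.seqNorm_singularValue hH haxJ).symm
    _ ≤ J.normE (ζ + ζ') := hJ.seqNorm_le_of_le hH hsum hle
    _ ≤ C * (J.normE ζ + J.normE ζ') := hC _ he _ ho
    _ = C * (J.normE (s * t) + J.normE (s * t)) := by
      rw [show J.normE ζ = J.normE (s * t) from hen, show J.normE ζ' = J.normE (s * t) from hon]
    _ = 2 * C * J.normE (s * t) := by ring

theorem exists_mul_mem_and_qnorm_le {C : ℝ} (hC0 : 0 ≤ C)
    (hC : ∀ ξ ∈ J.E, ∀ η ∈ J.E, J.normE (ξ + η) ≤ C * (J.normE ξ + J.normE η))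
    {ξ : ℕ → ℝ} (hξ : ξ ∈ J.dualE I) (hnull : Tendsto ξ atTop (𝓝 0)) (V : Ell2 →ₗᵢ[ℂ] H)
    {x : H →L[ℂ] H} (hx : x ∈ I.ideal) :
    diag V V ξ * x ∈ J.ideal ∧ ∃ ζ ∈ I.E, I.normE ζ = I.qnorm x ∧
      J.qnorm (diag V V ξ * x) ≤ 2 * C * J.normE (ξ * ζ) := by
  have hI := I.isSymmetricGauge
  have hxs := isSchmidt_singularValue hH (I.compact x hx)
  have hxE := (hI.singularValue_mem_iff hH (I.compact x hx)).2 hx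
  obtain ⟨h1, ζ, hζ, hζn, hle⟩ := exists_rearrangement_mul_le hH J I hξ hnull hxE
  obtain ⟨h2, h3⟩ := mul_mem_and_qnorm_le hH J hC (isSchmidt_diag V V hnull) hxs
    ((I.compact x hx).clm_comp (diag V V ξ)) h1
  exact ⟨h2, ζ, hζ, hζn.trans (hI.seqNorm_singularValue hH hx),
    h3.trans (mul_le_mul_of_nonneg_left hle (by positivity))⟩

theorem exists_normE_add_le : ∃ C : ℝ, 1 ≤ C ∧
    ∀ ξ ∈ J.E, ∀ η ∈ J.E, J.normE (ξ + η) ≤ C * (J.normE ξ + J.normE η) := by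
  obtain ⟨C, hC1, hC⟩ := J.add_le
  exact ⟨C, hC1, fun ξ hξ η hη => normE_add_le hH J hC hξ hη⟩

/-- Forward, diagonal operators multiply termwise; backward, the estimate for `diag V V ξ * x` with
arbitrary `x` in `I` is needed. -/
theorem EDual_eq_dualE (hIJ : ¬ I.ops ⊆ J.ops) : J.EDual I = J.dualE I := by
  obtain ⟨V⟩ := exists_isometry hH
  have hI := I.isSymmetricGauge
  have hJ := J.isSymmetricGauge
  have hD := isSymmetricGauge_dual hH J I hIJ
  ext ξ
  constructor
  · intro hξ
    have h1 := ((hD.mem_seqSpace_iff hH V V).1 hξ).2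
    have hb := BoundedSeq.of_tendsto hξ.1
    refine ⟨hb, fun η hη => (hJ.mem_seqSpace_iff hH V V).2 ⟨?_, ?_⟩⟩
    · have h := hξ.1.mul hη.1
      rwa [mul_zero] at h
    · rw [← diag_mul_diag V V V hb (BoundedSeq.of_tendsto hη.1)]
      exact h1 _ ((hI.mem_seqSpace_iff hH V V).1 hη).2
  · intro hξ
    have hnull := tendsto_of_mem_dualE hH J I hIJ hξ
    obtain ⟨C, hC1, hC⟩ := exists_normE_add_le hH J
    exact (hD.mem_seqSpace_iff hH V V).2 ⟨hnull, fun x hx =>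
      (exists_mul_mem_and_qnorm_le hH J I (zero_le_one.trans hC1) hC hξ hnull V hx).1⟩

theorem multiplierValues_normE_subset (V : Ell2 →ₗᵢ[ℂ] H) {ξ : ℕ → ℝ} (hξ : ξ ∈ J.dualE I) :
    multiplierValues J.normE I.E I.normE ξ ⊆
      multiplierValues J.qnorm I.ops I.qnorm (diag V V ξ) := by
  have hI := I.isSymmetricGauge
  have hJ := J.isSymmetricGauge
  rintro _ ⟨η, hη, hη1, rfl⟩
  refine ⟨diag V V η, ((hI.mem_seqSpace_iff hH V V).1 hη).2, ?_, ?_⟩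
  · rw [← hI.seqNorm_eq_diag hH V V hη]
    exact hη1
  · rw [diag_mul_diag V V V hξ.1 (BoundedSeq.of_tendsto hη.1)]
    exact hJ.seqNorm_eq_diag hH V V (hξ.2 η hη)

theorem bddAbove_multiplierValues_normE (hIJ : ¬ I.ops ⊆ J.ops) {ξ : ℕ → ℝ}
    (hξ : ξ ∈ J.dualE I) : BddAbove (multiplierValues J.normE I.E I.normE ξ) := by
  obtain ⟨V⟩ := exists_isometry hH
  have hξ' : ξ ∈ J.EDual I := by rwa [EDual_eq_dualE hH J I hIJ]
  have hD := isSymmetricGauge_dual hH J I hIJ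
  exact (bddAbove_multiplierValues hH I J ((hD.mem_seqSpace_iff hH V V).1 hξ').2).mono
    (multiplierValues_normE_subset hH J I V hξ)

theorem normDualE_le_normEDual (hIJ : ¬ I.ops ⊆ J.ops) {ξ : ℕ → ℝ} (hξ : ξ ∈ J.EDual I) :
    J.normDualE I ξ ≤ J.normEDual I ξ := by
  obtain ⟨V⟩ := exists_isometry hH
  have hD := isSymmetricGauge_dual hH J I hIJ
  have hξ' : ξ ∈ J.dualE I := by rwa [← EDual_eq_dualE hH J I hIJ]
  have h1 : J.normEDual I ξ = J.normDual I (diag V V ξ) := hD.seqNorm_eq_diag hH V V hξ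
  have hne : (multiplierValues J.normE I.E I.normE ξ).Nonempty := by
    have h0 : (0 : H →L[ℂ] H) ∈ I.ops := I.ideal.zero_mem
    have hI := I.isSymmetricGauge
    refine ⟨_, _, (hI.singularValue_mem_iff hH (I.compact 0 h0)).2 h0, ?_, rfl⟩
    refine (hI.seqNorm_singularValue hH h0).le.trans ?_
    rw [I.qnorm_zero]
    exact zero_le_one
  rw [h1]
  exact csSup_le_csSup (bddAbove_multiplierValues hH I J ((hD.mem_seqSpace_iff hH V V).1 hξ).2) hne
    (multiplierValues_normE_subset hH J I V hξ')

/-- `C` is any quasi-triangle constant of `E_J`, so that both the modulus of `J` and that of `E_J`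
can be inserted. -/
theorem normEDual_le (hIJ : ¬ I.ops ⊆ J.ops) {C : ℝ} (hC0 : 0 ≤ C)
    (hC : ∀ ξ ∈ J.E, ∀ η ∈ J.E, J.normE (ξ + η) ≤ C * (J.normE ξ + J.normE η))
    {ξ : ℕ → ℝ} (hξ : ξ ∈ J.EDual I) : J.normEDual I ξ ≤ 2 * C * J.normDualE I ξ := by
  obtain ⟨V⟩ := exists_isometry hH
  have hD := isSymmetricGauge_dual hH J I hIJ
  have hξ' : ξ ∈ J.dualE I := by rwa [← EDual_eq_dualE hH J I hIJ]
  have h1 : J.normEDual I ξ = J.normDual I (diag V V ξ) := hD.seqNorm_eq_diag hH V V hξ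
  rw [h1]
  refine csSup_le (multiplierValues_nonempty _ I _) ?_
  rintro _ ⟨x, hx, hx1, rfl⟩
  obtain ⟨-, ζ, hζ, hζn, hle⟩ := exists_mul_mem_and_qnorm_le hH J I hC0 hC hξ' hξ.1 V hx
  refine hle.trans (mul_le_mul_of_nonneg_left ?_ (by positivity))
  exact le_csSup (bddAbove_multiplierValues_normE hH J I hIJ hξ')
    ⟨ζ, hζ, hζn.trans_le hx1, rfl⟩

end SymmetricQuasiBanachIdeal

end CalkinDual
end

open CalkinDual CalkinDual.SymmetricQuasiBanachIdeal in
theorem theorem4p6 {H : Type*} [NormedAddCommGroup H] [InnerProductSpace ℂ H] [CompleteSpace H]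
    (hH : ¬ FiniteDimensional ℂ H)
    (I J : CalkinDual.SymmetricQuasiBanachIdeal H) (hIJ : ¬ I.ops ⊆ J.ops) :
    -- the quasi-norms of `J : I`, `E_J : E_I` and `E_{J:I}` are well defined
    (∀ a ∈ J.dual I, BddAbove (CalkinDual.multiplierValues J.qnorm I.ops I.qnorm a)) ∧
    (∀ ξ ∈ J.dualE I, BddAbove (CalkinDual.multiplierValues J.normE I.E I.normE ξ)) ∧
    (∀ a ∈ J.dual I, ∀ ξ ∈ J.EDual I,
      CalkinDual.rearrangement ξ = CalkinDual.singularValue a →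
        J.normEDual I ξ = J.normDual I a) ∧
    -- (i)
    (J.EDual I = J.dualE I ∧
      ∀ ξ ∈ J.EDual I,
        J.normDualE I ξ ≤ J.normEDual I ξ ∧
        J.normEDual I ξ ≤
          2 * CalkinDual.concavityModulus J.ops J.qnorm * J.normDualE I ξ) ∧
    -- (ii)
    (J.dual I = CalkinDual.opSpace H (J.dualE I) ∧
      ∀ a ∈ J.dual I,
        CalkinDual.opNorm (J.normDualE I) a ≤ J.normDual I a ∧
        J.normDual I a ≤
          2 * CalkinDual.concavityModulus J.E J.normE * CalkinDual.opNorm (J.normDualE I) a) := by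
  have hD := isSymmetricGauge_dual hH J I hIJ
  have hE := EDual_eq_dualE hH J I hIJ
  refine ⟨fun a ha => bddAbove_multiplierValues hH I J ha,
    fun ξ hξ => bddAbove_multiplierValues_normE hH J I hIJ hξ,
    fun a ha ξ _ h => hD.seqNorm_eq hH ha h, ⟨hE, fun ξ hξ => ⟨?_, ?_⟩⟩, ?_, fun a ha => ?_⟩
  · exact normDualE_le_normEDual hH J I hIJ hξ
  -- The modulus of `J` is a quasi-triangle constant of `E_J` too, by restriction to diagonal
  -- operators.
  · exact normEDual_le hH J I hIJ (concavityModulus_nonneg _ _) (fun ξ hξ η hη =>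
      normE_add_le hH J (fun x hx y hy => le_concavityModulus_mul J.nonneg J.add_le hx hy) hξ hη) hξ
  · ext a
    constructor
    · intro ha
      exact ⟨hD.compact a ha, hE ▸ (hD.singularValue_mem_iff hH (hD.compact a ha)).2 ha⟩
    · rintro ⟨hc, ha⟩
      rw [← hE] at ha
      exact (hD.singularValue_mem_iff hH hc).1 ha
  · have hs : singularValue a ∈ J.EDual I :=
      (hD.singularValue_mem_iff hH (hD.compact a ha)).2 ha
    have hn : J.normEDual I (singularValue a) = J.normDual I a := hD.seqNorm_singularValue hH ha
    rw [← hn]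
    exact ⟨normDualE_le_normEDual hH J I hIJ hs, normEDual_le hH J I hIJ
      (concavityModulus_nonneg _ _) (fun ξ hξ η hη => le_concavityModulus_mul
        (fun ζ hζ => normE_nonneg hH J hζ) (exists_normE_add_le hH J) hξ hη) hs⟩
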